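/- Let $m_1,m_2$ be nonnegative integers and let $\Phi_1$ be an $m_2\times m_1$ complex matrix function on $[0,\infty)$ which is boundedly differentiable on each finite interval $[0,l]$, that is, absolutely continuous on $[0,l]$ with bounded derivative (in particular, this holds if $\Phi_1$ is differentiable at every point of $[0,l]$ and $\Phi_1'$ is bounded there). For $0<l<\infty$ let $S_l$ be the bounded operator on $L^2_{m_2}(0,l)$ (the space of square integrable $\mathbb C^{m_2}$-valued functions on $(0,l)$) given by $$(S_lf)(x)=\big(I_{m_2}-\Phi_1(0)\Phi_1(0)^*\big)f(x)-\int_0^l s(x,t)f(t)\,dt,$$ $$s(x,t)=\int_0^{\min(x,t)}\Phi_1'(x-\zeta)\Phi_1'(t-\zeta)^*\,d\zeta+\begin{cases}\Phi_1'(x-t)\Phi_1(0)^*, & x>t,\\ \Phi_1(0)\Phi_1'(t-x)^*, & t>x.\end{cases}$$ Suppose that $\Phi_1(0)=0$ and that $S_l$ is boundedly invertible for every $0<l<\infty$. Then there is an $m_2\times m_2$ matrix function $E_\Phi(x,t)$, continuous on $\{(x,t):0\le t\le x<\infty\}$ and not depending on $l$, such that for every $0<l<\infty$ $$S_l^{-1}=E_{\Phi,l}^*E_{\Phi,l},\qquad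 (E_{\Phi,l}f)(x)=f(x)+\int_0^xE_\Phi(x,t)f(t)\,dt,\qquad E_{\Phi,l}\in B\big(L^2_{m_2}(0,l)\big).$$ Furthermore, such factorizations are unique: if $0<l<\infty$ and $E_1,E_2$ are $m_2\times m_2$ matrix functions, continuous on the triangle $\{(x,t):0\le t\le x\le l\}$, such that $S_l^{-1}=(I+V_k)^*(I+V_k)$ for $k=1,2$, where $V_k=\int_0^xE_k(x,t)\,\cdot\,dt$ on $L^2_{m_2}(0,l)$, then $E_1=E_2$ on this triangle. -/

import Mathlib

open MeasureTheory Set Matrix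

namespace DiracFactor

/-- The Hilbert space `L²_n(0, l)` of square integrable `ℂⁿ`-valued functions on `(0, l)`. -/
abbrev L2 (n : ℕ) (l : ℝ) : Type :=
  Lp (EuclideanSpace ℂ (Fin n)) 2 (volume.restrict (Ioo (0 : ℝ) l))

/-- The action `M v` of a square matrix on a vector of the Euclidean space `ℂⁿ`. -/
noncomputable abbrev act {n : ℕ} (M : Matrix (Fin n) (Fin n) ℂ) (v : EuclideanSpace ℂ (Fin n)) :
    EuclideanSpace ℂ (Fin n) :=
  Matrix.toEuclideanCLM (n := Fin n) (𝕜 := ℂ) M v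

/-- The entrywise derivative `Φ'(x)` of a matrix function. -/
noncomputable def dmat {m n : ℕ} (Φ : ℝ → Matrix (Fin m) (Fin n) ℂ) (x : ℝ) :
    Matrix (Fin m) (Fin n) ℂ :=
  Matrix.of fun i j => deriv (fun y => Φ y i j) x

/-- `Φ` is boundedly differentiable on `[0, l]`: it is absolutely continuous there (hence
differentiable almost everywhere) and its derivative is bounded. A function that is
differentiable at every point of `[0, l]` with a bounded derivative is a special case, see
`BoundedlyDifferentiable.of_hasDerivWithinAt`. -/
def BoundedlyDifferentiable {m n : ℕ} (Φ : ℝ → Matrix (Fin m) (Fin n) ℂ) (l : ℝ) : Prop :=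
  (∀ i j, AbsolutelyContinuousOnInterval (fun x => Φ x i j) 0 l) ∧
    ∃ M : ℝ, ∀ x ∈ Ioo 0 l, ∀ i j, ‖dmat Φ x i j‖ ≤ M

theorem BoundedlyDifferentiable.of_hasDerivWithinAt {m n : ℕ}
    {Φ Φ' : ℝ → Matrix (Fin m) (Fin n) ℂ} {l M : ℝ} (hl : 0 < l)
    (hd : ∀ i j, ∀ x ∈ Icc 0 l, HasDerivWithinAt (fun y => Φ y i j) (Φ' x i j) (Icc 0 l) x)
    (hM : ∀ i j, ∀ x ∈ Icc 0 l, ‖Φ' x i j‖ ≤ M) : BoundedlyDifferentiable Φ l := by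
  refine ⟨fun i j => ?_, M, fun x hx i j => ?_⟩
  · have h := (convex_Icc (0 : ℝ) l).lipschitzOnWith_of_nnnorm_hasDerivWithin_le
      (C := M.toNNReal) (hd i j) (fun x hx => by
        rw [← NNReal.coe_le_coe, coe_nnnorm]
        exact (hM i j x hx).trans (Real.le_coe_toNNReal M))
    rw [← uIcc_of_le hl.le] at h
    exact h.absolutelyContinuousOnInterval
  · have h := (hd i j x (Ioo_subset_Icc_self hx)).hasDerivAt (Icc_mem_nhds hx.1 hx.2)
    simp only [dmat, of_apply]
    rw [h.deriv]
    exact hM i j x (Ioo_subset_Icc_self hx)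

/-- The kernel
`s(x,t) = ∫₀^{min(x,t)} Φ'(x-ζ) Φ'(t-ζ)* dζ + (Φ'(x-t) Φ(0)* if x > t, Φ(0) Φ'(t-x)* if t > x)`;
the integral is taken entrywise, and nothing is added on the diagonal, a null set. -/
noncomputable def sKernel {m n : ℕ} (Φ : ℝ → Matrix (Fin m) (Fin n) ℂ) (x t : ℝ) :
    Matrix (Fin m) (Fin m) ℂ :=
  (Matrix.of fun i j => ∫ ζ in (0 : ℝ)..min x t, (dmat Φ (x - ζ) * (dmat Φ (t - ζ))ᴴ) i j) +
    if t < x then dmat Φ (x - t) * (Φ 0)ᴴ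
    else if x < t then Φ 0 * (dmat Φ (t - x))ᴴ
    else 0

/-- `S` is the operator
`(S f)(x) = (I - Φ(0) Φ(0)*) f(x) - ∫₀ˡ s(x,t) f(t) dt` on `L²_m(0, l)`. -/
def IsStructuredOp {m n : ℕ} (Φ : ℝ → Matrix (Fin m) (Fin n) ℂ) (l : ℝ)
    (S : L2 m l →L[ℂ] L2 m l) : Prop :=
  ∀ f : L2 m l, S f =ᵐ[volume.restrict (Ioo (0 : ℝ) l)]
    fun x => act (1 - Φ 0 * (Φ 0)ᴴ) (f x) - ∫ t in (0 : ℝ)..l, act (sKernel Φ x t) (f t)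

section Existence

theorem norm_act_le {n : ℕ} {C : ℝ} (hC : 0 ≤ C) (M : Matrix (Fin n) (Fin n) ℂ)
    (hM : ∀ i j, ‖M i j‖ ≤ C) (v : EuclideanSpace ℂ (Fin n)) :
    ‖act M v‖ ≤ (n * (n * C)) * ‖v‖ := by
  have h1 : ∀ w : EuclideanSpace ℂ (Fin n), ‖w‖ ≤ ∑ i, ‖w i‖ := by
    intro w
    rw [EuclideanSpace.norm_eq]
    refine Real.sqrt_le_iff.2 ⟨Finset.sum_nonneg fun _ _ => norm_nonneg _, ?_⟩
    exact Finset.sum_sq_le_sq_sum_of_nonneg fun _ _ => norm_nonneg _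
  refine (h1 _).trans ?_
  have h2 : ∀ i, ‖(act M v) i‖ ≤ n * C * ‖v‖ := by
    intro i
    have : (act M v) i = ∑ j, M i j * v j := rfl
    rw [this]
    refine (norm_sum_le _ _).trans ?_
    refine (Finset.sum_le_sum (g := fun _ => C * ‖v‖) fun j _ => ?_).trans ?_
    · rw [norm_mul]
      exact mul_le_mul (hM i j) (PiLp.norm_apply_le v j) (norm_nonneg _) hC
    · simp [mul_assoc]
  refine (Finset.sum_le_sum fun i _ => h2 i).trans ?_
  simp [mul_assoc]

theorem measurable_act {n : ℕ} {X : Type*} [MeasurableSpace X]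
    {K : X → Matrix (Fin n) (Fin n) ℂ} (hK : ∀ i j, Measurable fun p => K p i j)
    {v : X → EuclideanSpace ℂ (Fin n)} (hv : Measurable v) :
    Measurable fun p => act (K p) (v p) := by
  have : (fun p => act (K p) (v p)) =
      fun p => WithLp.toLp 2 (fun i => ∑ j, K p i j * v p j) := rfl
  rw [this]
  refine (WithLp.measurable_toLp 2 (Fin n → ℂ)).comp (measurable_pi_lambda _ fun i => ?_)
  refine Finset.measurable_sum _ fun j _ => (hK i j).mul ?_
  exact (measurable_pi_apply j).comp ((WithLp.measurable_ofLp 2 (Fin n → ℂ)).comp hv)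

/-- A bounded measurable matrix kernel defines a bounded integral operator. -/
theorem exists_integralOp {n : ℕ} {l : ℝ} (hl : 0 < l)
    (K : ℝ → ℝ → Matrix (Fin n) (Fin n) ℂ)
    (hK : ∀ i j, Measurable fun p : ℝ × ℝ => K p.1 p.2 i j) {C : ℝ} (hC : 0 ≤ C)
    (hb : ∀ x ∈ Ioo 0 l, ∀ t ∈ Ioo 0 l, ∀ i j, ‖K x t i j‖ ≤ C) :
    ∃ T : L2 n l →L[ℂ] L2 n l, ∀ f : L2 n l, T f =ᵐ[volume.restrict (Ioo (0 : ℝ) l)]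
      fun x => ∫ t in (0 : ℝ)..l, act (K x t) (f t) := by
  set μ : Measure ℝ := volume.restrict (Ioo (0 : ℝ) l) with hμ
  set D : ℝ := n * (n * C) with hD
  have hD0 : 0 ≤ D := by positivity
  have hint : ∀ g : ℝ → EuclideanSpace ℂ (Fin n),
      ∫ t in (0 : ℝ)..l, g t = ∫ t, g t ∂μ := fun g => by
    rw [intervalIntegral.integral_of_le hl.le, integral_Ioc_eq_integral_Ioo]
  have hI : ∀ f : L2 n l, Integrable f μ := fun f =>
    (Lp.memLp f).integrable (by norm_num)
  have hmeas : ∀ f : L2 n l, Measurable fun p : ℝ × ℝ => act (K p.1 p.2) (f p.2) := fun f =>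
    measurable_act hK ((Lp.stronglyMeasurable f).measurable.comp measurable_snd)
  have hbound : ∀ f : L2 n l, ∀ x ∈ Ioo 0 l, ∀ᵐ t ∂μ, ‖act (K x t) (f t)‖ ≤ D * ‖f t‖ := by
    intro f x hx
    filter_upwards [ae_restrict_mem measurableSet_Ioo] with t ht
    exact norm_act_le hC _ (hb x hx t ht) _
  have hKI : ∀ f : L2 n l, ∀ x ∈ Ioo 0 l, Integrable (fun t => act (K x t) (f t)) μ := by
    intro f x hx
    refine Integrable.mono' ((hI f).norm.const_mul D) ?_ (hbound f x hx)
    exact ((hmeas f).comp measurable_prodMk_left).aestronglyMeasurable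
  have hsm : ∀ f : L2 n l, StronglyMeasurable fun x => ∫ t, act (K x t) (f t) ∂μ := fun f =>
    (hmeas f).stronglyMeasurable.integral_prod_right'
  have hle : ∀ f : L2 n l, ∀ᵐ x ∂μ, ‖∫ t, act (K x t) (f t) ∂μ‖ ≤ D * ∫ t, ‖f t‖ ∂μ := by
    intro f
    filter_upwards [ae_restrict_mem measurableSet_Ioo] with x hx
    rw [← integral_const_mul]
    exact norm_integral_le_of_norm_le ((hI f).norm.const_mul D) (hbound f x hx)
  have hmem : ∀ f : L2 n l, MemLp (fun x => ∫ t, act (K x t) (f t) ∂μ) 2 μ := fun f =>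
    MemLp.of_bound (hsm f).aestronglyMeasurable _ (hle f)
  let T₀ : L2 n l →ₗ[ℂ] L2 n l :=
    { toFun := fun f => (hmem f).toLp _
      map_add' := by
        intro f g
        apply Lp.ext
        filter_upwards [(hmem (f + g)).coeFn_toLp, (hmem f).coeFn_toLp, (hmem g).coeFn_toLp,
          Lp.coeFn_add ((hmem f).toLp _) ((hmem g).toLp _),
          ae_restrict_mem measurableSet_Ioo] with x h1 h2 h3 h4 hx
        rw [h1, h4, Pi.add_apply, h2, h3, ← integral_add (hKI f x hx) (hKI g x hx)]
        refine integral_congr_ae ?_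
        filter_upwards [Lp.coeFn_add f g] with t ht
        rw [ht, Pi.add_apply, act, map_add]
      map_smul' := by
        intro c f
        apply Lp.ext
        filter_upwards [(hmem (c • f)).coeFn_toLp, (hmem f).coeFn_toLp,
          Lp.coeFn_smul c ((hmem f).toLp _)] with x h1 h2 h4
        rw [h1, RingHom.id_apply, h4, Pi.smul_apply, h2, ← integral_smul]
        refine integral_congr_ae ?_
        filter_upwards [Lp.coeFn_smul c f] with t ht
        rw [ht, Pi.smul_apply, act, map_smul] }
  have hL1 : ∃ B : ℝ, 0 ≤ B ∧ ∀ f : L2 n l, ∫ t, ‖f t‖ ∂μ ≤ B * ‖f‖ := by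
    refine ⟨(μ univ ^ ((1 : ENNReal).toReal⁻¹ - (2 : ENNReal).toReal⁻¹)).toReal,
      ENNReal.toReal_nonneg, fun f => ?_⟩
    have h := eLpNorm_le_eLpNorm_mul_rpow_measure_univ (p := 1) (q := 2) (μ := μ)
      (by norm_num) (Lp.memLp f).1
    rw [integral_norm_eq_lintegral_enorm (Lp.memLp f).1, ← eLpNorm_one_eq_lintegral_enorm,
      Lp.norm_def, mul_comm, ← ENNReal.toReal_mul]
    refine ENNReal.toReal_mono (ENNReal.mul_ne_top (Lp.eLpNorm_ne_top f) ?_) (by simpa using h)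
    exact ENNReal.rpow_ne_top_of_nonneg (by norm_num) (measure_ne_top μ _)
  obtain ⟨B, hB, hBf⟩ := hL1
  refine ⟨T₀.mkContinuous ((measureUnivNNReal μ : ℝ) ^ ((2 : ENNReal).toReal⁻¹) * (D * B))
    fun f => ?_, fun f => ?_⟩
  · have h := Lp.norm_le_of_ae_bound (f := T₀ f) (C := D * (B * ‖f‖)) (by positivity) (by
      filter_upwards [(hmem f).coeFn_toLp, hle f] with x h1 h2
      change ‖((hmem f).toLp _ : ℝ → EuclideanSpace ℂ (Fin n)) x‖ ≤ _
      rw [h1]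
      exact h2.trans (mul_le_mul_of_nonneg_left (hBf f) hD0))
    refine h.trans (le_of_eq ?_)
    ring
  · simp only [hint]
    exact (hmem f).coeFn_toLp

variable {m n : ℕ} {Φ : ℝ → Matrix (Fin m) (Fin n) ℂ} {l : ℝ}

theorem measurable_dmat (Φ : ℝ → Matrix (Fin m) (Fin n) ℂ) (i : Fin m) (j : Fin n) :
    Measurable fun x => dmat Φ x i j := by
  simp only [dmat, of_apply]
  exact measurable_deriv _

theorem measurable_sKernel (Φ : ℝ → Matrix (Fin m) (Fin n) ℂ) (i j : Fin m) :
    Measurable fun p : ℝ × ℝ => sKernel Φ p.1 p.2 i j := by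
  have hg : Measurable fun q : (ℝ × ℝ) × ℝ =>
      (dmat Φ (q.1.1 - q.2) * (dmat Φ (q.1.2 - q.2))ᴴ) i j := by
    simp only [mul_apply, conjTranspose_apply]
    refine Finset.measurable_sum _ fun k _ => ?_
    exact ((measurable_dmat Φ i k).comp (by fun_prop)).mul
      (continuous_star.measurable.comp ((measurable_dmat Φ j k).comp
        (f := fun q : (ℝ × ℝ) × ℝ => q.1.2 - q.2) (by fun_prop)))
  have hset : ∀ a b : ℝ × ℝ → ℝ, Measurable a → Measurable b →
      Measurable fun p : ℝ × ℝ => ∫ ζ in Ioc (a p) (b p),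
        (dmat Φ (p.1 - ζ) * (dmat Φ (p.2 - ζ))ᴴ) i j := by
    intro a b ha hb
    have hm : MeasurableSet {q : (ℝ × ℝ) × ℝ | q.2 ∈ Ioc (a q.1) (b q.1)} :=
      (measurableSet_lt (ha.comp measurable_fst) measurable_snd).inter
        (measurableSet_le measurable_snd (hb.comp measurable_fst))
    have h := (hg.indicator hm).stronglyMeasurable.integral_prod_right' (ν := volume)
    convert! h.measurable using 2 with p
    rw [← integral_indicator measurableSet_Ioc]
    rfl
  simp only [sKernel, Matrix.add_apply, of_apply, intervalIntegral]
  refine Measurable.add ((hset _ _ measurable_const (by fun_prop)).sub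
    (hset _ _ (by fun_prop) measurable_const)) ?_
  have h1 : Measurable fun p : ℝ × ℝ => (dmat Φ (p.1 - p.2) * (Φ 0)ᴴ) i j := by
    simp only [mul_apply]
    exact Finset.measurable_sum _ fun k _ =>
      ((measurable_dmat Φ i k).comp (by fun_prop)).mul_const _
  have h2 : Measurable fun p : ℝ × ℝ => (Φ 0 * (dmat Φ (p.2 - p.1))ᴴ) i j := by
    simp only [mul_apply, conjTranspose_apply]
    exact Finset.measurable_sum _ fun k _ =>
      (continuous_star.measurable.comp ((measurable_dmat Φ j k).comp
        (f := fun q : ℝ × ℝ => q.2 - q.1) (by fun_prop))).const_mul _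
  have h3 : Measurable fun p : ℝ × ℝ =>
      if p.2 < p.1 then (dmat Φ (p.1 - p.2) * (Φ 0)ᴴ) i j
      else if p.1 < p.2 then (Φ 0 * (dmat Φ (p.2 - p.1))ᴴ) i j else 0 :=
    Measurable.ite (measurableSet_lt measurable_snd measurable_fst) h1
      (Measurable.ite (measurableSet_lt measurable_fst measurable_snd) h2 measurable_const)
  convert! h3 using 2 with p
  split_ifs <;> rfl

theorem norm_sKernel_le (hl : 0 < l) (hΦ : BoundedlyDifferentiable Φ l) :
    ∃ C : ℝ, 0 ≤ C ∧ ∀ x ∈ Ioo 0 l, ∀ t ∈ Ioo 0 l, ∀ i j, ‖sKernel Φ x t i j‖ ≤ C := by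
  obtain ⟨-, M', hM'⟩ := hΦ
  obtain ⟨M, hM0, hM⟩ : ∃ M : ℝ, 0 ≤ M ∧ ∀ x ∈ Ioo 0 l, ∀ i j, ‖dmat Φ x i j‖ ≤ M :=
    ⟨max M' 0, le_max_right _ _, fun x hx i j => (hM' x hx i j).trans (le_max_left _ _)⟩
  obtain ⟨A, hA0, hA⟩ : ∃ A : ℝ, 0 ≤ A ∧ ∀ i j, ‖Φ 0 i j‖ ≤ A := by
    refine ⟨∑ i, ∑ j, ‖Φ 0 i j‖, by positivity, fun i j => ?_⟩
    exact (Finset.single_le_sum (f := fun j => ‖Φ 0 i j‖) (fun _ _ => norm_nonneg _)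
      (Finset.mem_univ j)).trans (Finset.single_le_sum (f := fun i => ∑ j, ‖Φ 0 i j‖)
        (fun _ _ => by positivity) (Finset.mem_univ i))
  have hmul : ∀ (P Q : Matrix (Fin m) (Fin n) ℂ) (a b : ℝ), 0 ≤ a → (∀ i j, ‖P i j‖ ≤ a) →
      (∀ i j, ‖Q i j‖ ≤ b) → ∀ i j, ‖(P * Qᴴ) i j‖ ≤ n * (a * b) := by
    intro P Q a b ha hP hQ i j
    rw [mul_apply]
    refine (norm_sum_le _ _).trans ((Finset.sum_le_sum (g := fun _ => a * b)
      fun k _ => ?_).trans (by simp))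
    rw [norm_mul, conjTranspose_apply, norm_star]
    exact mul_le_mul (hP i k) (hQ j k) (norm_nonneg _) ha
  refine ⟨n * (M * M) * l + (n * (M * A) + n * (A * M)), by positivity, ?_⟩
  intro x hx t ht i j
  have hmin : 0 < min x t := lt_min hx.1 ht.1
  rw [sKernel, Matrix.add_apply]
  refine (norm_add_le _ _).trans (add_le_add ?_ ?_)
  · rw [of_apply, intervalIntegral.integral_of_le hmin.le, integral_Ioc_eq_integral_Ioo]
    refine (norm_setIntegral_le_of_norm_le_const (C := n * (M * M)) (by simp) ?_).trans ?_
    · intro ζ hζ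
      have h1 : ζ < x := hζ.2.trans_le (min_le_left _ _)
      have h2 : ζ < t := hζ.2.trans_le (min_le_right _ _)
      exact hmul _ _ M M hM0 (hM _ ⟨by linarith, by linarith [hζ.1, hx.2]⟩)
        (hM _ ⟨by linarith, by linarith [hζ.1, ht.2]⟩) i j
    · rw [Real.volume_real_Ioo_of_le hmin.le]
      refine mul_le_mul_of_nonneg_left ?_ (by positivity)
      linarith [min_le_left x t, hx.2]
  · have p1 : 0 ≤ n * (M * A) := by positivity
    have p2 : 0 ≤ n * (A * M) := by positivity
    split_ifs with h1 h2
    · exact (hmul _ _ M A hM0 (hM _ ⟨by linarith, by linarith [ht.1, hx.2]⟩) hA i j).trans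
        (by linarith)
    · exact (hmul _ _ A M hA0 hA (hM _ ⟨by linarith, by linarith [hx.1, ht.2]⟩) i j).trans
        (by linarith)
    · simpa using add_nonneg p1 p2

theorem exists_isStructuredOp (hl : 0 < l) (hΦ : BoundedlyDifferentiable Φ l) :
    ∃ S : L2 m l →L[ℂ] L2 m l, IsStructuredOp Φ l S := by
  obtain ⟨C, hC, hb⟩ := norm_sKernel_le hl hΦ
  obtain ⟨T, hT⟩ := exists_integralOp hl (sKernel Φ) (measurable_sKernel Φ) hC hb
  refine ⟨(Matrix.toEuclideanCLM (n := Fin m) (𝕜 := ℂ) (1 - Φ 0 * (Φ 0)ᴴ)).compLpL 2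
    (volume.restrict (Ioo (0 : ℝ) l)) - T, fun f => ?_⟩
  rw [_root_.sub_apply]
  filter_upwards [Lp.coeFn_sub ((Matrix.toEuclideanCLM (n := Fin m) (𝕜 := ℂ)
    (1 - Φ 0 * (Φ 0)ᴴ)).compLpL 2 (volume.restrict (Ioo (0 : ℝ) l)) f) (T f),
    ContinuousLinearMap.coeFn_compLpL (Matrix.toEuclideanCLM (n := Fin m) (𝕜 := ℂ)
    (1 - Φ 0 * (Φ 0)ᴴ)) f, hT f] with x h1 h2 h3
  rw [h1, Pi.sub_apply, h2, h3]

end Existence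

/-- The operator `S_l` on `L²_m(0, l)`, determined by
`(S_l f)(x) = (I - Φ(0) Φ(0)*) f(x) - ∫₀ˡ s(x,t) f(t) dt`. -/
noncomputable def structuredOp {m n : ℕ} (Φ : ℝ → Matrix (Fin m) (Fin n) ℂ) {l : ℝ} (hl : 0 < l)
    (hΦ : BoundedlyDifferentiable Φ l) : L2 m l →L[ℂ] L2 m l :=
  (exists_isStructuredOp hl hΦ).choose

theorem structuredOp_spec {m n : ℕ} (Φ : ℝ → Matrix (Fin m) (Fin n) ℂ) {l : ℝ} (hl : 0 < l)
    (hΦ : BoundedlyDifferentiable Φ l) : IsStructuredOp Φ l (structuredOp Φ hl hΦ) :=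
  (exists_isStructuredOp hl hΦ).choose_spec

/-- The closed triangle `0 ≤ t ≤ x ≤ l` of pairs `(x, t)`. -/
def triangle (l : ℝ) : Set (ℝ × ℝ) := {p | 0 ≤ p.2 ∧ p.2 ≤ p.1 ∧ p.1 ≤ l}

/-- The bounded operator `T` on `L²_n(0, l)` is `I + ∫₀ˣ E(x,t) · dt`. -/
def IsVolterra {n : ℕ} (E : ℝ → ℝ → Matrix (Fin n) (Fin n) ℂ) (l : ℝ)
    (T : L2 n l →L[ℂ] L2 n l) : Prop :=
  ∀ f : L2 n l, T f =ᵐ[volume.restrict (Ioo (0 : ℝ) l)]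
    fun x => f x + ∫ t in (0 : ℝ)..x, act (E x t) (f t)

/-- `S⁻¹ = T* T`, where `T = I + ∫₀ˣ E(x,t) · dt` is a bounded operator on `L²_n(0, l)`. -/
def InverseFactorization {n : ℕ} {l : ℝ} (S : L2 n l →L[ℂ] L2 n l)
    (E : ℝ → ℝ → Matrix (Fin n) (Fin n) ℂ) : Prop :=
  ∃ T : L2 n l →L[ℂ] L2 n l, IsVolterra E l T ∧
    Ring.inverse S = ContinuousLinearMap.adjoint T * T

end DiracFactor

/-! Since Φ(0) = 0, `S_l` is I minus an integral operator with Hermitian kernel k = s. The kernel is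
continuous because it is a sum of truncated correlations of L² functions and translation is
continuous in L². Let `P_a` (`trunc`) be the projection onto functions vanishing beyond a. The
Volterra operators I + V preserve the complementary spaces (they are lower triangular: P_a T (1 -
P_a) = 0), and their adjoints preserve the ranges of the `P_a`.

The factor comes from the resolvent equation E(x,t) - ∫₀ˣ E(x,r) k(r,t) dr = k(x,t) for 0 ≤ t ≤ x.
For fixed x this is an equation with the operator S_x on (0,x), so it is solvable and its solution
does not involve l. Invertibility for every x gives continuity of E, because operator inversion is
continuous (`exists_resolvent`). The equation says exactly that T S maps the range of each `P_a`
into itself (`upper_of_resolvent`).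

Then A = T S T* - 1 also maps these ranges into themselves, and A is self-adjoint, so it commutes
with every `P_a`. Such an operator is block diagonal for every partition of (0,l), hence its norm is
the largest block norm. Each term of A contains a factor bounded from L² to L^∞, or the adjoint of
one, so a block on an interval of length h has norm O(√h). Refining the partition gives A = 0
(`eq_zero_of_commute_trunc`). As T is invertible, T S T* = 1 yields S⁻¹ = T* T. Positivity of S is
never needed.

For uniqueness, Q = T₂ T₁⁻¹ satisfies Q* Q = 1, and both Q and Q* = T₁ T₂⁻¹ are lower triangular. So
Q commutes with every `P_a`, and the same vanishing principle gives Q = 1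
(`volterra_factor_unique`). A continuous kernel is recovered from its operator by testing on small
boxes (`kernel_eqOn_of_isVolterra`). -/

namespace DiracFactor

/-! ### Matrices acting on vectors -/

section Act

theorem act_apply {n : ℕ} (M : Matrix (Fin n) (Fin n) ℂ) (v : EuclideanSpace ℂ (Fin n))
    (i : Fin n) : act M v i = ∑ j, M i j * v j := rfl

theorem inner_act_left {n : ℕ} (M : Matrix (Fin n) (Fin n) ℂ) (v w : EuclideanSpace ℂ (Fin n)) :
    inner ℂ (act M v) w = inner ℂ v (act Mᴴ w) := by
  have h : Matrix.toEuclideanCLM (n := Fin n) (𝕜 := ℂ) Mᴴ =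
      ContinuousLinearMap.adjoint (Matrix.toEuclideanCLM (n := Fin n) (𝕜 := ℂ) M) :=
    map_star (Matrix.toEuclideanCLM (n := Fin n) (𝕜 := ℂ)) M
  rw [act, act, h, ContinuousLinearMap.adjoint_inner_right]

theorem act_one {n : ℕ} (v : EuclideanSpace ℂ (Fin n)) : act 1 v = v := by
  simp [act]

theorem act_basis {n : ℕ} (M : Matrix (Fin n) (Fin n) ℂ) (i j : Fin n) :
    act M (EuclideanSpace.single j 1) i = M i j := by
  simp [act_apply]

theorem continuousOn_act {n : ℕ} {X : Type*} [TopologicalSpace X] {s : Set X}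
    {K : X → Matrix (Fin n) (Fin n) ℂ} (hK : ContinuousOn K s)
    {v : X → EuclideanSpace ℂ (Fin n)} (hv : ContinuousOn v s) :
    ContinuousOn (fun p => act (K p) (v p)) s := by
  have : (fun p => act (K p) (v p)) =
      fun p => WithLp.toLp 2 (fun i => ∑ j, K p i j * v p j) := rfl
  rw [this]
  refine (PiLp.continuous_toLp 2 _).comp_continuousOn (continuousOn_pi.2 fun i => ?_)
  refine continuousOn_finsetSum _ fun j _ => ContinuousOn.mul ?_ ?_
  · exact continuousOn_pi.1 (continuousOn_pi.1 hK i) j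
  · exact continuousOn_pi.1 ((PiLp.continuous_ofLp 2 _).comp_continuousOn hv) j

theorem continuous_act {n : ℕ} {X : Type*} [TopologicalSpace X]
    {K : X → Matrix (Fin n) (Fin n) ℂ} (hK : Continuous K)
    {v : X → EuclideanSpace ℂ (Fin n)} (hv : Continuous v) :
    Continuous (fun p => act (K p) (v p)) :=
  continuousOn_univ.1 (continuousOn_act hK.continuousOn hv.continuousOn)

/-- On a compact set a continuous matrix function acts with uniformly bounded norm. -/
theorem exists_norm_act_le {n : ℕ} {X : Type*} [TopologicalSpace X] {s : Set X}
    (hs : IsCompact s) {K : X → Matrix (Fin n) (Fin n) ℂ} (hK : ContinuousOn K s) :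
    ∃ D : ℝ, 0 ≤ D ∧ ∀ p ∈ s, ∀ v, ‖act (K p) v‖ ≤ D * ‖v‖ := by
  have h : ∀ i j, ∃ C : ℝ, ∀ p ∈ s, ‖K p i j‖ ≤ C := fun i j =>
    hs.exists_bound_of_continuousOn (continuousOn_pi.1 (continuousOn_pi.1 hK i) j)
  choose C hC using h
  refine ⟨n * (n * ∑ i, ∑ j, |C i j|), by positivity, fun p hp v =>
    norm_act_le (by positivity) _ (fun i j => ((hC i j p hp).trans (le_abs_self _)).trans ?_) v⟩
  exact (Finset.single_le_sum (f := fun j => |C i j|) (fun _ _ => abs_nonneg _)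
      (Finset.mem_univ j)).trans (Finset.single_le_sum (f := fun i => ∑ j, |C i j|)
        (fun _ _ => by positivity) (Finset.mem_univ i))

end Act

/-! ### The chain of truncation projections and the vanishing principle -/

section Truncation

variable {n : ℕ} {l : ℝ}

/-- The orthogonal projection of `L²_n(0, l)` onto the functions vanishing beyond `a`. -/
noncomputable def trunc (n : ℕ) (l a : ℝ) : L2 n l →L[ℂ] L2 n l :=
  LinearMap.mkContinuous
    { toFun := fun f => ((Lp.memLp f).indicator (measurableSet_Iic (a := a))).toLp _
      map_add' := by
        intro f g
        rw [← MemLp.toLp_add]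
        refine MemLp.toLp_congr _ _ ?_
        filter_upwards [Lp.coeFn_add f g] with x hx
        simp only [indicator, Pi.add_apply]
        split_ifs
        · exact hx
        · simp
      map_smul' := by
        intro c f
        rw [RingHom.id_apply, ← MemLp.toLp_const_smul]
        refine MemLp.toLp_congr _ _ ?_
        filter_upwards [Lp.coeFn_smul c f] with x hx
        simp only [indicator, Pi.smul_apply]
        split_ifs
        · exact hx
        · simp } 1 (fun f => by
    rw [one_mul]
    refine Lp.norm_le_norm_of_ae_le ?_
    filter_upwards [((Lp.memLp f).indicator (measurableSet_Iic (a := a))).coeFn_toLp] with x hx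
    change ‖(((Lp.memLp f).indicator (measurableSet_Iic (a := a))).toLp _ :
      ℝ → EuclideanSpace ℂ (Fin n)) x‖ ≤ _
    rw [hx]
    exact norm_indicator_le_norm_self _ _)

theorem trunc_ae (a : ℝ) (f : L2 n l) :
    trunc n l a f =ᵐ[volume.restrict (Ioo (0 : ℝ) l)] (Iic a).indicator f :=
  ((Lp.memLp f).indicator (measurableSet_Iic (a := a))).coeFn_toLp

theorem trunc_mul_trunc (a b : ℝ) : trunc n l a * trunc n l b = trunc n l (min a b) := by
  ext1 f
  apply Lp.ext
  rw [mul_apply_eq_comp]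
  filter_upwards [trunc_ae a (trunc n l b f), trunc_ae b f, trunc_ae (min a b) f] with x h1 h2 h3
  rw [h1, h3, indicator, indicator, h2, indicator]
  simp only [mem_Iic, le_min_iff]
  split_ifs <;> simp_all

theorem trunc_of_le {a : ℝ} (ha : l ≤ a) : trunc n l a = 1 := by
  ext1 f
  apply Lp.ext
  filter_upwards [trunc_ae a f, ae_restrict_mem measurableSet_Ioo] with x h1 hx
  rw [h1, indicator_of_mem (show x ∈ Iic a from hx.2.le.trans ha)]
  rfl

theorem trunc_of_nonpos {a : ℝ} (ha : a ≤ 0) : trunc n l a = 0 := by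
  ext1 f
  apply Lp.ext
  filter_upwards [trunc_ae a f, ae_restrict_mem measurableSet_Ioo,
    Lp.coeFn_zero (EuclideanSpace ℂ (Fin n)) 2 (volume.restrict (Ioo (0 : ℝ) l))] with x h1 hx h0
  rw [h1, indicator_of_notMem (show x ∉ Iic a from fun h => absurd hx.1 (not_lt.2 (h.trans ha)))]
  exact h0.symm

theorem adjoint_trunc (a : ℝ) : ContinuousLinearMap.adjoint (trunc n l a) = trunc n l a := by
  symm
  rw [ContinuousLinearMap.eq_adjoint_iff]
  intro f g
  rw [L2.inner_def, L2.inner_def]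
  refine integral_congr_ae ?_
  filter_upwards [trunc_ae a f, trunc_ae a g] with x h1 h2
  rw [h1, h2, indicator, indicator]
  split_ifs <;> simp

/-- A bounded operator from `L²` to `L^∞` is small on short intervals. -/
theorem norm_trunc_sub_le {A : L2 n l →L[ℂ] L2 n l} {C : ℝ} (hC : 0 ≤ C)
    (hA : ∀ f : L2 n l, ∀ᵐ x ∂(volume.restrict (Ioo (0 : ℝ) l)), ‖A f x‖ ≤ C * ‖f‖)
    {a b : ℝ} (hab : a ≤ b) :
    ‖(trunc n l b - trunc n l a) * A‖ ≤ C * √(b - a) := by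
  refine ContinuousLinearMap.opNorm_le_bound _ (by positivity) fun f => ?_
  set g := ((trunc n l b - trunc n l a) * A) f with hg
  have hgae : g =ᵐ[volume.restrict (Ioo (0 : ℝ) l)] (Ioc a b).indicator (A f) := by
    rw [hg, mul_apply_eq_comp, _root_.sub_apply]
    filter_upwards [trunc_ae a (A f), trunc_ae b (A f), Lp.coeFn_sub (trunc n l b (A f))
      (trunc n l a (A f))] with x h1 h2 h3
    rw [h3, Pi.sub_apply, h1, h2]
    simp only [indicator, mem_Iic, mem_Ioc]
    by_cases h4 : x ≤ a
    · simp [h4, h4.trans hab]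
    · simp [h4, not_le.1 h4]
  have h1 : eLpNorm g 2 (volume.restrict (Ioo (0 : ℝ) l)) ≤
      ENNReal.ofReal (b - a) ^ (2 : ENNReal).toReal⁻¹ * ENNReal.ofReal (C * ‖f‖) := by
    rw [eLpNorm_congr_ae hgae, eLpNorm_indicator_eq_eLpNorm_restrict measurableSet_Ioc]
    refine (eLpNorm_le_of_ae_bound (ae_restrict_of_ae (hA f))).trans ?_
    gcongr
    rw [Measure.restrict_apply_univ, Measure.restrict_apply measurableSet_Ioc, ← Real.volume_Ioc]
    exact measure_mono inter_subset_left
  rw [Lp.norm_def]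
  refine (ENNReal.toReal_mono (ENNReal.mul_ne_top (by simp) ENNReal.ofReal_ne_top) h1).trans ?_
  rw [ENNReal.toReal_mul, ← ENNReal.toReal_rpow, ENNReal.toReal_ofReal (by linarith),
    ENNReal.toReal_ofReal (by positivity), Real.sqrt_eq_rpow]
  simp
  linarith

/-- An operator commuting with all truncations and small on short intervals is zero. -/
theorem eq_zero_of_commute_trunc {A : L2 n l →L[ℂ] L2 n l} (hl : 0 < l)
    (hcomm : ∀ a, Commute (trunc n l a) A) {C : ℝ} (hC : 0 ≤ C)
    (hA : ∀ a b, a ≤ b → ‖(trunc n l b - trunc n l a) * A * (trunc n l b - trunc n l a)‖ ≤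
      C * √(b - a)) : A = 0 := by
  set P := trunc n l
  have hPP : ∀ a b, P a * P b = P (min a b) := trunc_mul_trunc
  -- Bisection: A commutes with the projections onto the two halves, so the block on (a,b] is the
  -- orthogonal sum of the two half blocks and its norm is at most the larger of theirs. Each
  -- halving therefore gains a factor √2 with no loss from summation.
  have key : ∀ N : ℕ, ∀ a b, a ≤ b →
      ‖(P b - P a) * A * (P b - P a)‖ ≤ C * √((b - a) / 2 ^ N) := by
    intro N
    induction N with
    | zero => simpa using hA
    | succ N ih =>
      intro a b hab
      set c := (a + b) / 2 with hc
      have hac : a ≤ c := by linarith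
      have hcb : c ≤ b := by linarith
      set R := P c - P a with hR
      set Q := P b - P c with hQ
      have hRR : R * R = R := by
        simp [hR, mul_sub, sub_mul, hPP, hac]
      have hQQ : Q * Q = Q := by
        simp [hQ, mul_sub, sub_mul, hPP, hcb]
      have hRQ : R * Q = 0 := by
        simp [hR, hQ, mul_sub, sub_mul, hPP, hcb, hac, hab]
      have hQR : Q * R = 0 := by
        simp [hR, hQ, mul_sub, sub_mul, hPP, hcb, hac, hab]
      have hsum : P b - P a = R + Q := by simp [hR, hQ]
      have hRA : R * A = A * R := ((hcomm c).sub_left (hcomm a)).eq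
      have hQA : Q * A = A * Q := ((hcomm b).sub_left (hcomm c)).eq
      have hRs : ContinuousLinearMap.adjoint R = R := by
        rw [hR, map_sub, adjoint_trunc, adjoint_trunc]
      have hdec : (P b - P a) * A * (P b - P a) = R * A * R + Q * A * Q := by
        have e1 : R * A * Q = 0 := by rw [hRA, mul_assoc, hRQ, mul_zero]
        have e2 : Q * A * R = 0 := by rw [hQA, mul_assoc, hQR, mul_zero]
        rw [hsum, add_mul, add_mul, mul_add, mul_add, e1, e2]
        simp
      have hpyth : ∀ u v : L2 n l, ‖R u + Q v‖ ^ 2 = ‖R u‖ ^ 2 + ‖Q v‖ ^ 2 := by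
        intro u v
        have : inner ℂ (R u) (Q v) = 0 := by
          rw [← ContinuousLinearMap.adjoint_inner_right, hRs, ← mul_apply_eq_comp, hRQ]
          simp
        have h := norm_add_sq_eq_norm_sq_add_norm_sq_of_inner_eq_zero (R u) (Q v) this
        simpa [sq] using h
      set D := C * √((b - a) / 2 ^ (N + 1)) with hD
      have hD0 : 0 ≤ D := by positivity
      have hRn : ‖R * A * R‖ ≤ D := by
        refine (ih a c hac).trans (le_of_eq ?_)
        rw [hD, hc]; congr 2; field_simp; ring
      have hQn : ‖Q * A * Q‖ ≤ D := by
        refine (ih c b hcb).trans (le_of_eq ?_)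
        rw [hD, hc]; congr 2; field_simp; ring
      -- Bounding by ‖Z f‖ rather than ‖f‖ lets Pythagoras recombine the two halves with the same
      -- constant.
      have hsq : ∀ {B Z : L2 n l →L[ℂ] L2 n l}, Z * Z = Z → ‖Z * B * Z‖ ≤ D → ∀ f,
          ‖Z (B (Z f))‖ ^ 2 ≤ D ^ 2 * ‖Z f‖ ^ 2 := by
        intro B Z hZ hB f
        rw [← mul_pow]
        refine pow_le_pow_left₀ (norm_nonneg _) ?_ 2
        have h1 := ((Z * B * Z).le_opNorm (Z f)).trans
          (mul_le_mul_of_nonneg_right hB (norm_nonneg _))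
        rwa [show (Z * B * Z) (Z f) = (Z * B * (Z * Z)) f from rfl, hZ] at h1
      refine ContinuousLinearMap.opNorm_le_bound _ hD0 fun f => ?_
      refine le_of_sq_le_sq ?_ (by positivity)
      rw [hdec, mul_pow]
      change ‖R (A (R f)) + Q (A (Q f))‖ ^ 2 ≤ _
      rw [hpyth]
      have h1 := hsq hRR hRn f
      have h2 := hsq hQQ hQn f
      have h3 : ‖R f‖ ^ 2 + ‖Q f‖ ^ 2 ≤ ‖f‖ ^ 2 := by
        rw [← hpyth]
        refine pow_le_pow_left₀ (norm_nonneg _) ?_ 2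
        rw [← _root_.add_apply, ← hsum]
        refine Lp.norm_le_norm_of_ae_le ?_
        rw [_root_.sub_apply]
        filter_upwards [trunc_ae a f, trunc_ae b f, Lp.coeFn_sub (P b f) (P a f)] with x h1 h2 h3
        rw [h3, Pi.sub_apply, h1, h2, indicator, indicator]
        split_ifs <;> simp
      nlinarith [sq_nonneg D]
  have h0 : ∀ N : ℕ, ‖A‖ ≤ C * √(l / 2 ^ N) := by
    intro N
    have h := key N 0 l hl.le
    rwa [show P l = 1 from trunc_of_le le_rfl, show P 0 = 0 from trunc_of_nonpos le_rfl,
      sub_zero, sub_zero, one_mul, mul_one] at h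
  have hlim : Filter.Tendsto (fun N : ℕ => C * √(l / 2 ^ N)) Filter.atTop (nhds 0) := by
    have h1 : Filter.Tendsto (fun N : ℕ => l / 2 ^ N) Filter.atTop (nhds 0) :=
      Filter.Tendsto.const_div_atTop (tendsto_pow_atTop_atTop_of_one_lt one_lt_two) l
    simpa using (h1.sqrt).const_mul C
  exact norm_le_zero_iff.1 (ge_of_tendsto' hlim h0)

end Truncation

/-! ### Operators dominated by a scalar Volterra operator -/

section VolterraBounded

variable {n : ℕ} {l : ℝ}

/-- The operator `V` is dominated pointwise by the Volterra operator `D ∫₀ˣ ‖f(t)‖ dt`. -/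
def VolterraBounded (D : ℝ) (V : L2 n l →L[ℂ] L2 n l) : Prop :=
  ∀ f : L2 n l, ∀ᵐ x ∂(volume.restrict (Ioo (0 : ℝ) l)), ‖V f x‖ ≤ D * ∫ t in (0 : ℝ)..x, ‖f t‖

theorem integral_restrict_Ioo_eq {E : Type*} [NormedAddCommGroup E] [NormedSpace ℝ E]
    (hl : 0 ≤ l) (g : ℝ → E) :
    ∫ t, g t ∂(volume.restrict (Ioo (0 : ℝ) l)) = ∫ t in (0 : ℝ)..l, g t := by
  rw [intervalIntegral.integral_of_le hl, integral_Ioc_eq_integral_Ioo]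

theorem integrable_L2 (f : L2 n l) : Integrable f (volume.restrict (Ioo (0 : ℝ) l)) :=
  (Lp.memLp f).integrable (by norm_num)

theorem intervalIntegrable_norm_L2 (f : L2 n l) {x : ℝ} (hx : x ∈ Icc 0 l) :
    IntervalIntegrable (fun t => ‖f t‖) volume 0 x := by
  rw [intervalIntegrable_iff_integrableOn_Ioo_of_le hx.1]
  exact IntegrableOn.mono_set (integrable_L2 f).norm (Ioo_subset_Ioo_right hx.2)

theorem exists_integral_norm_le (hl : 0 ≤ l) : ∃ B : ℝ, 0 ≤ B ∧ ∀ f : L2 n l, ∀ x ∈ Icc 0 l,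
    ∫ t in (0 : ℝ)..x, ‖f t‖ ≤ B * ‖f‖ := by
  set μ := volume.restrict (Ioo (0 : ℝ) l)
  -- The constant is √l, from the Cauchy–Schwarz inequality on an interval of length l.
  refine ⟨(μ univ ^ ((1 : ENNReal).toReal⁻¹ - (2 : ENNReal).toReal⁻¹)).toReal,
    ENNReal.toReal_nonneg, fun f x hx => ?_⟩
  have h := eLpNorm_le_eLpNorm_mul_rpow_measure_univ (p := 1) (q := 2) (μ := μ)
    (by norm_num) (Lp.memLp f).1
  have h2 : ∫ t in (0 : ℝ)..x, ‖f t‖ ≤ ∫ t in (0 : ℝ)..l, ‖f t‖ :=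
    intervalIntegral.integral_mono_interval le_rfl hx.1 hx.2
      (Filter.Eventually.of_forall fun _ => norm_nonneg _)
      (intervalIntegrable_norm_L2 f (right_mem_Icc.2 hl))
  refine h2.trans ?_
  rw [← integral_restrict_Ioo_eq hl,
    integral_norm_eq_lintegral_enorm (Lp.memLp f).1, ← eLpNorm_one_eq_lintegral_enorm,
    Lp.norm_def, mul_comm, ← ENNReal.toReal_mul]
  refine ENNReal.toReal_mono (ENNReal.mul_ne_top (Lp.eLpNorm_ne_top f) ?_) (by simpa using h)
  exact ENNReal.rpow_ne_top_of_nonneg (by norm_num) (measure_ne_top μ _)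

/-- The L¹ norm is controlled by the L² norm. The resulting L² to L^∞ bound is the input of
`norm_trunc_sub_le` and the base case of `pow_bound`. -/
theorem VolterraBounded.exists_bound {D : ℝ} {V : L2 n l →L[ℂ] L2 n l}
    (hV : VolterraBounded D V) (hD : 0 ≤ D) (hl : 0 ≤ l) :
    ∃ C : ℝ, 0 ≤ C ∧ ∀ f : L2 n l, ∀ᵐ x ∂(volume.restrict (Ioo (0 : ℝ) l)),
      ‖V f x‖ ≤ C * ‖f‖ := by
  obtain ⟨B, hB, hBf⟩ := exists_integral_norm_le (n := n) hl
  refine ⟨D * B, by positivity, fun f => ?_⟩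
  filter_upwards [hV f, ae_restrict_mem measurableSet_Ioo] with x h1 hx
  rw [mul_assoc]
  exact h1.trans (mul_le_mul_of_nonneg_left (hBf f x (Ioo_subset_Icc_self hx)) hD)

theorem VolterraBounded.trunc_mul {D : ℝ} {V : L2 n l →L[ℂ] L2 n l}
    (hV : VolterraBounded D V) (a : ℝ) : VolterraBounded D (trunc n l a * V) := by
  intro f
  filter_upwards [hV f, trunc_ae a (V f)] with x h1 h2
  rw [mul_apply_eq_comp, h2]
  exact (norm_indicator_le_norm_self _ _).trans h1

/-- The value of V g at x ≤ a is controlled by g on (0,x), where g = (1 - P_a) f vanishes. -/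
theorem VolterraBounded.lower {D : ℝ} {V : L2 n l →L[ℂ] L2 n l}
    (hV : VolterraBounded D V) (a : ℝ) : trunc n l a * V * (1 - trunc n l a) = 0 := by
  ext1 f
  set g := (1 - trunc n l a) f with hg
  have hgae : ∀ᵐ x ∂(volume.restrict (Ioo (0 : ℝ) l)), x ≤ a → g x = 0 := by
    rw [hg, _root_.sub_apply]
    filter_upwards [trunc_ae a f, Lp.coeFn_sub ((1 : L2 n l →L[ℂ] L2 n l) f)
      (trunc n l a f)] with x h1 h2 hx
    rw [h2, Pi.sub_apply, h1, indicator_of_mem (show x ∈ Iic a from hx)]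
    simp
  apply Lp.ext
  filter_upwards [trunc_ae a (V g), hV g, ae_restrict_mem measurableSet_Ioo,
    Lp.coeFn_zero (EuclideanSpace ℂ (Fin n)) 2 (volume.restrict (Ioo (0 : ℝ) l))]
    with x h1 h2 hx h0
  change trunc n l a (V g) x = (0 : L2 n l) x
  rw [h1, h0, Pi.zero_apply, indicator_apply_eq_zero]
  intro hxa
  have hz : ∫ t in (0 : ℝ)..x, ‖g t‖ = 0 := by
    rw [intervalIntegral.integral_of_le hx.1.le, integral_Ioc_eq_integral_Ioo]
    refine integral_eq_zero_of_ae ?_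
    have h3 := ae_restrict_of_ae_restrict_of_subset (Ioo_subset_Ioo_right hx.2.le) hgae
    filter_upwards [h3, ae_restrict_mem measurableSet_Ioo] with t ht htx
    simp [ht (htx.2.le.trans hxa)]
  rw [hz, mul_zero] at h2
  exact norm_le_zero_iff.1 h2

/-- The classical iteration: each further V integrates the bound for the previous power, and ∫₀ˣ tᴺ
dt produces the factorial. -/
theorem VolterraBounded.pow_bound {D : ℝ} {V : L2 n l →L[ℂ] L2 n l}
    (hV : VolterraBounded D V) (hD : 0 ≤ D) {C : ℝ}
    (hC : ∀ f : L2 n l, ∀ᵐ x ∂(volume.restrict (Ioo (0 : ℝ) l)), ‖V f x‖ ≤ C * ‖f‖) (N : ℕ)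
    (f : L2 n l) : ∀ᵐ x ∂(volume.restrict (Ioo (0 : ℝ) l)),
      ‖(V ^ (N + 1)) f x‖ ≤ C * ‖f‖ * ((D * x) ^ N / N.factorial) := by
  induction N with
  | zero => simpa using hC f
  | succ N ih =>
    rw [pow_succ', mul_apply_eq_comp]
    filter_upwards [hV ((V ^ (N + 1)) f), ae_restrict_mem measurableSet_Ioo] with x h1 hx
    refine h1.trans ?_
    have h2 : ∫ t in (0 : ℝ)..x, ‖(V ^ (N + 1)) f t‖ ≤
        ∫ t in (0 : ℝ)..x, C * ‖f‖ * ((D * t) ^ N / N.factorial) := by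
      refine intervalIntegral.integral_mono_ae_restrict hx.1.le
        (intervalIntegrable_norm_L2 _ (Ioo_subset_Icc_self hx))
        (Continuous.intervalIntegrable (by fun_prop) _ _) ?_
      rw [← restrict_Ioo_eq_restrict_Icc]
      exact ae_restrict_of_ae_restrict_of_subset (Ioo_subset_Ioo_right hx.2.le) ih
    refine (mul_le_mul_of_nonneg_left h2 hD).trans (le_of_eq ?_)
    simp only [mul_pow, intervalIntegral.integral_const_mul, intervalIntegral.integral_div,
      integral_pow]
    rw [Nat.factorial_succ]
    push_cast
    field_simp
    ring

/-- By the factorial bound some power of V has norm below 1, so 1 - (-V)^(N+1) is a unit. It is the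
product of 1 + V with a commuting geometric sum, hence 1 + V is a unit too. -/
theorem VolterraBounded.isUnit_one_add {D : ℝ} {V : L2 n l →L[ℂ] L2 n l}
    (hV : VolterraBounded D V) (hD : 0 ≤ D) (hl : 0 ≤ l) : IsUnit (1 + V) := by
  obtain ⟨C, hC0, hC⟩ := hV.exists_bound hD hl
  -- B = √l converts an essential sup bound into an L² bound.
  set B : ℝ := (measureUnivNNReal (volume.restrict (Ioo (0 : ℝ) l)) : ℝ) ^ ((2 : ENNReal).toReal⁻¹)
    with hB
  have hB0 : 0 ≤ B := by positivity
  have hn : ∀ N : ℕ, ‖V ^ (N + 1)‖ ≤ B * (C * ((D * l) ^ N / N.factorial)) := by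
    intro N
    refine ContinuousLinearMap.opNorm_le_bound _ (by positivity) fun f => ?_
    have h := Lp.norm_le_of_ae_bound (f := (V ^ (N + 1)) f)
      (C := C * ‖f‖ * ((D * l) ^ N / N.factorial)) (by positivity) (by
        filter_upwards [hV.pow_bound hD hC N f, ae_restrict_mem measurableSet_Ioo] with x h1 hx
        refine h1.trans ?_
        have := hx.1
        have := hx.2
        gcongr)
    refine h.trans (le_of_eq ?_)
    ring
  have hlim : Filter.Tendsto (fun N : ℕ => B * (C * ((D * l) ^ N / N.factorial)))
      Filter.atTop (nhds 0) := by
    simpa using ((FloorSemiring.tendsto_pow_div_factorial_atTop (D * l)).const_mul C).const_mul B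
  obtain ⟨N, hN⟩ := (hlim.eventually (gt_mem_nhds one_pos)).exists
  have hu : IsUnit (1 - (-V) ^ (N + 1)) := by
    refine isUnit_one_sub_of_norm_lt_one ?_
    rw [neg_pow]
    refine (norm_mul_le _ _).trans_lt (lt_of_le_of_lt ?_ hN)
    refine le_trans ?_ (hn N)
    have : ‖(-1 : L2 n l →L[ℂ] L2 n l) ^ (N + 1)‖ ≤ 1 := by
      rcases neg_one_pow_eq_or (L2 n l →L[ℂ] L2 n l) (N + 1) with h | h <;> rw [h]
      · exact ContinuousLinearMap.norm_id_le
      · rw [norm_neg]; exact ContinuousLinearMap.norm_id_le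
    exact mul_le_of_le_one_left (norm_nonneg _) this
  have hmul : (1 - -V) * ∑ i ∈ Finset.range (N + 1), (-V) ^ i = 1 - (-V) ^ (N + 1) :=
    mul_neg_geom_sum (-V) (N + 1)
  have hmul' : (∑ i ∈ Finset.range (N + 1), (-V) ^ i) * (1 - -V) = 1 - (-V) ^ (N + 1) :=
    geom_sum_mul_neg (-V) (N + 1)
  have hc : Commute (1 - -V) (∑ i ∈ Finset.range (N + 1), (-V) ^ i) := hmul.trans hmul'.symm
  rw [← hmul, hc.isUnit_mul_iff] at hu
  simpa using hu.1

/-- Triangularity P V = P V P gives (1 + P V) P = P (1 + V), so multiplying the claim on the left by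
1 + P V reduces it to P (1 - P) = 0. That multiplier is invertible because P V is again Volterra
bounded. -/
theorem VolterraBounded.lower_inverse {D : ℝ} {V : L2 n l →L[ℂ] L2 n l}
    (hV : VolterraBounded D V) (hD : 0 ≤ D) (hl : 0 ≤ l) (a : ℝ) :
    trunc n l a * Ring.inverse (1 + V) * (1 - trunc n l a) = 0 := by
  set P := trunc n l a
  have hPP : P * P = P := by simp [P, trunc_mul_trunc]
  have hu := hV.isUnit_one_add hD hl
  have hPu := (hV.trunc_mul a).isUnit_one_add hD hl
  have h1 : P * V = P * V * P := by
    have := hV.lower a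
    rw [mul_sub, mul_one, sub_eq_zero] at this
    exact this
  have h2 : (1 + P * V) * P = P * (1 + V) := by
    rw [add_mul, one_mul, mul_add, mul_one, ← h1]
  refine hPu.mul_left_cancel ?_
  rw [mul_zero, ← mul_assoc, ← mul_assoc, h2, mul_assoc P, Ring.mul_inverse_cancel _ hu, mul_one,
    mul_sub, mul_one, hPP, sub_self]

end VolterraBounded

/-! ### From continuous kernels on the triangle to Volterra bounds -/

section KernelBound

variable {n : ℕ} {l : ℝ}

theorem isCompact_triangle (l : ℝ) : IsCompact (triangle l) := by
  refine (isCompact_Icc.prod isCompact_Icc : IsCompact (Icc 0 l ×ˢ Icc 0 l)).of_isClosed_subset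
    ?_ ?_
  · exact (isClosed_le continuous_const continuous_snd).inter
      ((isClosed_le continuous_snd continuous_fst).inter
        (isClosed_le continuous_fst continuous_const))
  · rintro ⟨x, t⟩ ⟨h1, h2, h3⟩
    exact ⟨⟨h1.trans h2, h3⟩, ⟨h1, h2.trans h3⟩⟩

theorem IsVolterra.sub_one_ae {E : ℝ → ℝ → Matrix (Fin n) (Fin n) ℂ} {T : L2 n l →L[ℂ] L2 n l}
    (hT : IsVolterra E l T) (f : L2 n l) : (T - 1) f =ᵐ[volume.restrict (Ioo (0 : ℝ) l)]
      fun x => ∫ t in (0 : ℝ)..x, act (E x t) (f t) := by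
  rw [_root_.sub_apply]
  filter_upwards [hT f, Lp.coeFn_sub (T f) ((1 : L2 n l →L[ℂ] L2 n l) f)] with x h1 h2
  rw [h2, Pi.sub_apply, h1, one_apply_eq_self, add_sub_cancel_left]

theorem IsVolterra.volterraBounded {E : ℝ → ℝ → Matrix (Fin n) (Fin n) ℂ}
    (hE : ContinuousOn (Function.uncurry E) (triangle l)) {T : L2 n l →L[ℂ] L2 n l}
    (hT : IsVolterra E l T) : ∃ D, 0 ≤ D ∧ VolterraBounded D (T - 1) := by
  obtain ⟨D, hD, hDE⟩ := exists_norm_act_le (isCompact_triangle l) hE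
  refine ⟨D, hD, fun f => ?_⟩
  filter_upwards [hT.sub_one_ae f, ae_restrict_mem measurableSet_Ioo] with x h1 hx
  rw [h1, ← intervalIntegral.integral_const_mul]
  refine intervalIntegral.norm_integral_le_of_norm_le hx.1.le ?_
    ((intervalIntegrable_norm_L2 f (Ioo_subset_Icc_self hx)).const_mul D)
  exact Filter.Eventually.of_forall fun t ht => hDE (x, t) ⟨ht.1.le, ht.2, hx.2.le⟩ (f t)

end KernelBound

/-! ### Operators I - K with continuous Hermitian kernel -/

section HermitianKernel

variable {n : ℕ} {l : ℝ} {k : ℝ → ℝ → Matrix (Fin n) (Fin n) ℂ} {S : L2 n l →L[ℂ] L2 n l}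

/-- The bounded operator `S` on `L²_n(0, l)` is `I - ∫₀ˡ k(x,t) · dt`. -/
def IsOneSubKernel (k : ℝ → ℝ → Matrix (Fin n) (Fin n) ℂ) (l : ℝ)
    (S : L2 n l →L[ℂ] L2 n l) : Prop :=
  ∀ f : L2 n l, S f =ᵐ[volume.restrict (Ioo (0 : ℝ) l)]
    fun x => f x - ∫ t in (0 : ℝ)..l, act (k x t) (f t)

theorem aestronglyMeasurable_act {X : Type*} [MeasurableSpace X] {μ : Measure X}
    {K : X → Matrix (Fin n) (Fin n) ℂ} (hK : ∀ i j, AEStronglyMeasurable (fun p => K p i j) μ)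
    {v : X → EuclideanSpace ℂ (Fin n)} (hv : AEStronglyMeasurable v μ) :
    AEStronglyMeasurable (fun p => act (K p) (v p)) μ := by
  have : (fun p => act (K p) (v p)) =
      fun p => ∑ i, (∑ j, K p i j * v p j) • EuclideanSpace.single i (1 : ℂ) := by
    ext p i
    simp [act_apply, Finset.sum_apply, Pi.single_apply]
  rw [this]
  refine Finset.aestronglyMeasurable_fun_sum _ fun i _ => AEStronglyMeasurable.smul_const ?_ _
  refine Finset.aestronglyMeasurable_fun_sum _ fun j _ => (hK i j).mul ?_
  exact (EuclideanSpace.proj (𝕜 := ℂ) j).continuous.comp_aestronglyMeasurable hv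

theorem integrableOn_act {K : ℝ → Matrix (Fin n) (Fin n) ℂ} {a b : ℝ}
    (hK : ContinuousOn K (Icc a b)) {f : ℝ → EuclideanSpace ℂ (Fin n)}
    (hf : IntegrableOn f (Icc a b)) : IntegrableOn (fun t => act (K t) (f t)) (Icc a b) := by
  obtain ⟨D, hD, hDK⟩ := exists_norm_act_le isCompact_Icc hK
  refine Integrable.mono' (hf.norm.const_mul D) (aestronglyMeasurable_act (fun i j => ?_) hf.1) ?_
  · exact ContinuousOn.aestronglyMeasurable
      (continuousOn_pi.1 (continuousOn_pi.1 hK i) j) measurableSet_Icc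
  · filter_upwards [ae_restrict_mem measurableSet_Icc] with t ht
    exact hDK t ht _

theorem integrableOn_Icc_L2 (f : L2 n l) {x : ℝ} (hx : x ≤ l) : IntegrableOn f (Icc 0 x) := by
  rw [integrableOn_Icc_iff_integrableOn_Ioo]
  exact IntegrableOn.mono_set (integrable_L2 f) (Ioo_subset_Ioo_right hx)

theorem intervalIntegrable_act {K : ℝ → Matrix (Fin n) (Fin n) ℂ} {x : ℝ} (hx : x ∈ Icc 0 l)
    (hK : ContinuousOn K (Icc 0 x)) (f : L2 n l) :
    IntervalIntegrable (fun t => act (K t) (f t)) volume 0 x := by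
  rw [intervalIntegrable_iff_integrableOn_Icc_of_le hx.1]
  exact integrableOn_act hK (integrableOn_Icc_L2 f hx.2)

theorem IsOneSubKernel.one_sub_ae (hS : IsOneSubKernel k l S) (f : L2 n l) :
    (1 - S) f =ᵐ[volume.restrict (Ioo (0 : ℝ) l)] fun x => ∫ t in (0 : ℝ)..l, act (k x t) (f t) := by
  rw [_root_.sub_apply]
  filter_upwards [hS f, Lp.coeFn_sub ((1 : L2 n l →L[ℂ] L2 n l) f) (S f)] with x h1 h2
  rw [h2, Pi.sub_apply, h1, one_apply_eq_self, sub_sub_cancel]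

theorem IsOneSubKernel.exists_bound (hk : Continuous (Function.uncurry k)) (hl : 0 ≤ l)
    (hS : IsOneSubKernel k l S) :
    ∃ C : ℝ, 0 ≤ C ∧ ∀ f : L2 n l, ∀ᵐ x ∂(volume.restrict (Ioo (0 : ℝ) l)),
      ‖(1 - S) f x‖ ≤ C * ‖f‖ := by
  obtain ⟨B, hB, hBf⟩ := exists_integral_norm_le (n := n) hl
  obtain ⟨D, hD, hDk⟩ := exists_norm_act_le
    (isCompact_Icc.prod isCompact_Icc : IsCompact (Icc 0 l ×ˢ Icc 0 l)) hk.continuousOn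
  refine ⟨D * B, by positivity, fun f => ?_⟩
  filter_upwards [hS.one_sub_ae f, ae_restrict_mem measurableSet_Ioo] with x h1 hx
  have hl' : l ∈ Icc 0 l := right_mem_Icc.2 hl
  rw [h1, mul_assoc]
  refine le_trans ?_ (mul_le_mul_of_nonneg_left (hBf f l hl') hD)
  rw [← intervalIntegral.integral_const_mul]
  refine intervalIntegral.norm_integral_le_of_norm_le hl ?_
    ((intervalIntegrable_norm_L2 f hl').const_mul D)
  exact Filter.Eventually.of_forall fun t ht =>
    hDk (x, t) ⟨Ioo_subset_Icc_self hx, ht.1.le, ht.2⟩ (f t)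

/-- Fubini together with k(x,t)* = k(t,x). The integrand is dominated by D ‖h(x)‖ ‖f(t)‖, which is
integrable since L² functions on a finite interval lie in L¹. -/
theorem IsOneSubKernel.adjoint_eq (hk : Continuous (Function.uncurry k))
    (hsymm : ∀ x t, (k x t)ᴴ = k t x) (hl : 0 ≤ l) (hS : IsOneSubKernel k l S) :
    ContinuousLinearMap.adjoint S = S := by
  set μ := volume.restrict (Ioo (0 : ℝ) l) with hμ
  have hmeas : ∀ i j, Measurable fun p : ℝ × ℝ => k p.1 p.2 i j := fun i j =>
    ((continuous_apply j).comp ((continuous_apply i).comp hk)).measurable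
  obtain ⟨D, hD, hDk⟩ := exists_norm_act_le
    (isCompact_Icc.prod isCompact_Icc : IsCompact (Icc 0 l ×ˢ Icc 0 l)) hk.continuousOn
  have hint : ∀ f h : L2 n l, Integrable (Function.uncurry fun x t =>
      inner ℂ (act (k x t) (f t)) (h x)) (μ.prod μ) := by
    intro f h
    have hdom : Integrable (fun p : ℝ × ℝ => D * (‖h p.1‖ * ‖f p.2‖)) (μ.prod μ) :=
      ((integrable_L2 h).norm.mul_prod (integrable_L2 f).norm).const_mul D
    refine Integrable.mono' hdom ?_ ?_
    · refine (Measurable.inner ?_ ?_).aestronglyMeasurable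
      · exact measurable_act hmeas ((Lp.stronglyMeasurable f).measurable.comp measurable_snd)
      · exact (Lp.stronglyMeasurable h).measurable.comp measurable_fst
    · rw [hμ, Measure.prod_restrict]
      filter_upwards [ae_restrict_mem (measurableSet_Ioo.prod measurableSet_Ioo)] with p hp
      refine (norm_inner_le_norm _ _).trans ?_
      have := hDk p ⟨Ioo_subset_Icc_self hp.1, Ioo_subset_Icc_self hp.2⟩ (f p.2)
      calc _ ≤ (D * ‖f p.2‖) * ‖h p.1‖ := mul_le_mul_of_nonneg_right this (norm_nonneg _)
        _ = _ := by ring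
  have hrow : ∀ (f : L2 n l) (x : ℝ), Integrable (fun t => act (k x t) (f t)) μ := by
    intro f x
    have := integrableOn_act (K := k x) (a := 0) (b := l) (f := f) (by
      exact (hk.comp (Continuous.prodMk_right x)).continuousOn) (integrableOn_Icc_L2 f le_rfl)
    exact this.mono_set Ioo_subset_Icc_self
  have hK : ∀ f h : L2 n l, inner ℂ ((1 - S) f) h = inner ℂ f ((1 - S) h) := by
    intro f h
    rw [L2.inner_def, L2.inner_def]
    have e1 : ∫ x, inner ℂ ((1 - S) f x) (h x) ∂μ =
        ∫ x, ∫ t, inner ℂ (act (k x t) (f t)) (h x) ∂μ ∂μ := by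
      refine integral_congr_ae ?_
      filter_upwards [hS.one_sub_ae f] with x h1
      rw [h1, ← integral_restrict_Ioo_eq hl, ← inner_conj_symm, ← integral_inner (hrow f x),
        ← integral_conj]
      simp only [inner_conj_symm]
    have e2 : ∫ t, inner ℂ (f t) ((1 - S) h t) ∂μ =
        ∫ t, ∫ x, inner ℂ (act (k x t) (f t)) (h x) ∂μ ∂μ := by
      refine integral_congr_ae ?_
      filter_upwards [hS.one_sub_ae h] with t h1
      rw [h1, ← integral_restrict_Ioo_eq hl, ← integral_inner (hrow h t)]
      simp only [inner_act_left, hsymm]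
    rw [e1, e2, integral_integral_swap (hint f h)]
  symm
  rw [ContinuousLinearMap.eq_adjoint_iff]
  intro f h
  have := hK f h
  simp only [_root_.sub_apply, one_apply_eq_self, inner_sub_left, inner_sub_right,
    sub_right_inj] at this
  exact this

/-- A continuous kernel on the triangle defines a bounded operator `I + ∫₀ˣ E(x,t) · dt`. -/
theorem exists_isVolterra {E : ℝ → ℝ → Matrix (Fin n) (Fin n) ℂ} (hl : 0 < l)
    (hE : ContinuousOn (Function.uncurry E) (triangle l)) :
    ∃ T : L2 n l →L[ℂ] L2 n l, IsVolterra E l T := by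
  classical
  have hms : MeasurableSet (triangle l) := (isCompact_triangle l).measurableSet
  set K : ℝ → ℝ → Matrix (Fin n) (Fin n) ℂ := fun x t => if (x, t) ∈ triangle l then E x t else 0
    with hK
  have hcont : ∀ i j, ContinuousOn (fun p : ℝ × ℝ => E p.1 p.2 i j) (triangle l) := fun i j =>
    continuousOn_pi.1 (continuousOn_pi.1 hE i) j
  have hmeas : ∀ i j, Measurable fun p : ℝ × ℝ => K p.1 p.2 i j := by
    intro i j
    have : (fun p : ℝ × ℝ => K p.1 p.2 i j) =
        (triangle l).piecewise (fun p : ℝ × ℝ => E p.1 p.2 i j) fun _ => 0 := by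
      ext p
      simp only [hK, piecewise]
      split_ifs <;> rfl
    rw [this]
    exact ContinuousOn.measurable_piecewise (hcont i j) continuousOn_const hms
  have hb : ∀ i j, ∃ C : ℝ, ∀ p ∈ triangle l, ‖E p.1 p.2 i j‖ ≤ C := fun i j =>
    (isCompact_triangle l).exists_bound_of_continuousOn (hcont i j)
  choose C hC using hb
  have hbd : ∀ x ∈ Ioo 0 l, ∀ t ∈ Ioo 0 l, ∀ i j, ‖K x t i j‖ ≤ ∑ i, ∑ j, |C i j| := by
    intro x _ t _ i j
    have h1 : |C i j| ≤ ∑ i, ∑ j, |C i j| :=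
      (Finset.single_le_sum (f := fun j => |C i j|) (fun _ _ => abs_nonneg _)
        (Finset.mem_univ j)).trans (Finset.single_le_sum (f := fun i => ∑ j, |C i j|)
          (fun _ _ => by positivity) (Finset.mem_univ i))
    simp only [hK]
    split_ifs with h
    · exact ((hC i j _ h).trans (le_abs_self _)).trans h1
    · simpa using (abs_nonneg _).trans h1
  obtain ⟨V, hV⟩ := exists_integralOp hl K hmeas (by positivity) hbd
  refine ⟨1 + V, fun f => ?_⟩
  rw [_root_.add_apply]
  filter_upwards [hV f, Lp.coeFn_add ((1 : L2 n l →L[ℂ] L2 n l) f) (V f),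
    ae_restrict_mem measurableSet_Ioo] with x h1 h2 hx
  rw [h2, Pi.add_apply, h1, one_apply_eq_self]
  congr 1
  rw [intervalIntegral.integral_of_le hl.le, intervalIntegral.integral_of_le hx.1.le,
    ← inter_eq_right.2 (Ioc_subset_Ioc_right hx.2.le : Ioc 0 x ⊆ Ioc 0 l),
    ← setIntegral_indicator measurableSet_Ioc]
  refine setIntegral_congr_fun measurableSet_Ioc fun t ht => ?_
  simp only [indicator, mem_Ioc, hK, triangle, mem_ofPred_eq, ht.1, ht.1.le, true_and, hx.2.le,
    and_true]
  split_ifs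
  · rfl
  · simp [act]

end HermitianKernel

/-! ### The factorization S⁻¹ = T* T from the resolvent equation -/

section Factorization

variable {n : ℕ} {l : ℝ} {k : ℝ → ℝ → Matrix (Fin n) (Fin n) ℂ} {S T : L2 n l →L[ℂ] L2 n l}

/-- If the rows of `E` solve the resolvent equation, then `T S - I` is upper triangular. -/
theorem upper_of_resolvent {E : ℝ → ℝ → Matrix (Fin n) (Fin n) ℂ}
    (hk : Continuous (Function.uncurry k)) (hsymm : ∀ x t, (k x t)ᴴ = k t x) (hl : 0 < l)
    (hS : IsOneSubKernel k l S) (hE : ContinuousOn (Function.uncurry E) (triangle l))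
    (hT : IsVolterra E l T) {g : ℝ → Fin n → ℝ → EuclideanSpace ℂ (Fin n)}
    (hg : ∀ x ∈ Ioo 0 l, ∀ j, ContinuousOn (g x j) (Icc 0 x))
    (hEg : ∀ x ∈ Ioo 0 l, ∀ t ∈ Icc 0 x, ∀ i j, E x t j i = star (g x j t i))
    (heq : ∀ x ∈ Ioo 0 l, ∀ j, ∀ t ∈ Icc 0 x,
      g x j t - ∫ r in (0 : ℝ)..x, act (k t r) (g x j r) = act (k t x) (EuclideanSpace.single j 1))
    (a : ℝ) : (1 - trunc n l a) * (T * S) * trunc n l a = 0 := by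
  set μ := volume.restrict (Ioo (0 : ℝ) l) with hμ
  have hkrow : ∀ x, Continuous (k x) := fun x => hk.comp (Continuous.prodMk_right x)
  ext1 f'
  set f := trunc n l a f' with hf
  have hfa : ∀ᵐ x ∂μ, a < x → f x = 0 := by
    filter_upwards [trunc_ae a f'] with x h1 hx
    rw [hf, h1, indicator_of_notMem (show x ∉ Iic a from not_le.2 hx)]
  -- With f(x) = 0 for x > a, the claim becomes ∫₀ˣ E(x,r) (S f)(r) dr = ∫₀ˡ k(x,t) f(t) dt. In
  -- coordinate j the left side is ⟨G, S f⟩ = ⟨S G, f⟩, with G the conjugated row j of E(x,·)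
  -- extended by zero, and the resolvent equation identifies S G.
  have main : ∀ᵐ x ∂μ, a < x → T (S f) x = 0 := by
    filter_upwards [hT (S f), hS f, hfa, ae_restrict_mem measurableSet_Ioo] with x h1 h2 h3 hx hax
    have hxI : x ∈ Icc 0 l := Ioo_subset_Icc_self hx
    have hlI : l ∈ Icc 0 l := right_mem_Icc.2 hl.le
    rw [h1, h2, h3 hax, zero_sub, neg_add_eq_sub, sub_eq_zero]
    ext j
    have hErow : ContinuousOn (E x) (Icc 0 x) := by
      refine ContinuousOn.comp (g := Function.uncurry E) hE
        (Continuous.prodMk_right x).continuousOn fun t ht => ?_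
      exact ⟨ht.1, ht.2, hx.2.le⟩
    have c1 := (EuclideanSpace.proj (𝕜 := ℂ) j).intervalIntegral_comp_comm
      (intervalIntegrable_act hxI hErow (S f))
    have c2 := (EuclideanSpace.proj (𝕜 := ℂ) j).intervalIntegral_comp_comm
      (intervalIntegrable_act hlI (hkrow x).continuousOn f)
    simp only [PiLp.proj_apply] at c1 c2
    rw [← c1, ← c2]
    -- the `j`-th row of `E` as an element of `L²`
    obtain ⟨C, hC⟩ := isCompact_Icc.exists_bound_of_continuousOn (hg x hx j)
    have hC0 : 0 ≤ C := (norm_nonneg _).trans (hC 0 ⟨le_rfl, hx.1.le⟩)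
    have hGmem : MemLp ((Icc 0 x).indicator (g x j)) 2 μ := by
      refine MemLp.of_bound (C := C) ?_ ?_
      · refine AEStronglyMeasurable.restrict ?_
        exact (aestronglyMeasurable_indicator_iff measurableSet_Icc).2
          ((hg x hx j).aestronglyMeasurable measurableSet_Icc)
      · refine Filter.Eventually.of_forall fun t => ?_
        by_cases ht : t ∈ Icc 0 x
        · rw [indicator_of_mem ht]; exact hC t ht
        · rw [indicator_of_notMem ht]; simpa using hC0
    set G : L2 n l := hGmem.toLp _ with hG
    have hGae : G =ᵐ[μ] (Icc 0 x).indicator (g x j) := hGmem.coeFn_toLp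
    have d1 : ∫ r in (0 : ℝ)..x, act (E x r) (S f r) j = inner ℂ G (S f) := by
      rw [L2.inner_def]
      have : ∫ r, inner ℂ (G r) (S f r) ∂μ =
          ∫ r, (Icc 0 x).indicator (fun r => act (E x r) (S f r) j) r ∂μ := by
        refine integral_congr_ae ?_
        filter_upwards [hGae] with r hr
        rw [hr]
        by_cases hrx : r ∈ Icc 0 x
        · rw [indicator_of_mem hrx, indicator_of_mem hrx, act_apply, PiLp.inner_apply]
          refine Finset.sum_congr rfl fun i _ => ?_
          rw [hEg x hx r hrx i j, RCLike.inner_apply, mul_comm]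
          rfl
        · rw [indicator_of_notMem hrx, indicator_of_notMem hrx, inner_zero_left]
      rw [this, integral_indicator measurableSet_Icc, hμ,
        Measure.restrict_restrict measurableSet_Icc, intervalIntegral.integral_of_le hx.1.le]
      rw [integral_Ioc_eq_integral_Ioo]
      refine setIntegral_congr_set ?_
      have : Icc 0 x ∩ Ioo 0 l = Ioc 0 x := by
        ext r
        simp only [mem_inter_iff, mem_Icc, mem_Ioo, mem_Ioc]
        exact ⟨fun h => ⟨h.2.1, h.1.2⟩, fun h => ⟨⟨h.1.le, h.2⟩, h.1, h.2.trans_lt hx.2⟩⟩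
      rw [this]
      exact Ioo_ae_eq_Ioc
    -- The identity (S G)(t) = k(t,x) e_j is available only for t ≤ x; this suffices because f
    -- vanishes beyond a < x.
    have d2 : inner ℂ (S G) f = ∫ t in (0 : ℝ)..l, act (k x t) (f t) j := by
      rw [L2.inner_def, ← integral_restrict_Ioo_eq hl.le]
      refine integral_congr_ae ?_
      filter_upwards [hS G, hfa, hGae, ae_restrict_mem measurableSet_Ioo] with t ht1 ht2 ht3 ht
      rcases lt_or_ge a t with hat | hat
      · simp [ht2 hat]
      have htx : t ∈ Icc 0 x := ⟨ht.1.le, hat.trans hax.le⟩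
      have : ∫ r in (0 : ℝ)..l, act (k t r) (G r) = ∫ r in (0 : ℝ)..x, act (k t r) (g x j r) := by
        rw [← integral_restrict_Ioo_eq hl.le]
        have e : ∫ r, act (k t r) (G r) ∂μ =
            ∫ r, (Icc 0 x).indicator (fun r => act (k t r) (g x j r)) r ∂μ := by
          refine integral_congr_ae ?_
          filter_upwards [hGae] with r hr
          rw [hr]
          by_cases hrx : r ∈ Icc 0 x
          · rw [indicator_of_mem hrx, indicator_of_mem hrx]
          · rw [indicator_of_notMem hrx, indicator_of_notMem hrx, act, map_zero]
        rw [e, integral_indicator measurableSet_Icc, hμ,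
          Measure.restrict_restrict measurableSet_Icc, intervalIntegral.integral_of_le hx.1.le]
        congr 2
        ext r
        simp only [mem_inter_iff, mem_Icc, mem_Ioo, mem_Ioc]
        exact ⟨fun h => ⟨h.2.1, h.1.2⟩, fun h => ⟨⟨h.1.le, h.2⟩, h.1, h.2.trans_lt hx.2⟩⟩
      rw [ht1, this, ht3, indicator_of_mem htx, heq x hx j t htx, inner_act_left, hsymm,
        EuclideanSpace.inner_single_left]
      simp
    rw [d1, ← d2, ← hS.adjoint_eq hk hsymm hl.le, ContinuousLinearMap.adjoint_inner_left,
      hS.adjoint_eq hk hsymm hl.le]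
  apply Lp.ext
  change (T (S f) - trunc n l a (T (S f)) : L2 n l) =ᵐ[μ] (0 : L2 n l)
  filter_upwards [main, trunc_ae a (T (S f)), Lp.coeFn_sub (T (S f)) (trunc n l a (T (S f))),
    Lp.coeFn_zero (EuclideanSpace ℂ (Fin n)) 2 μ] with x h1 h2 h3 h0
  rw [h3, Pi.sub_apply, h2, h0, Pi.zero_apply, sub_eq_zero]
  rcases le_or_gt x a with hx | hx
  · rw [indicator_of_mem (show x ∈ Iic a from hx)]
  · rw [indicator_of_notMem (show x ∉ Iic a from not_le.2 hx), h1 hx]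

theorem norm_trunc_le (a : ℝ) : ‖trunc n l a‖ ≤ 1 :=
  LinearMap.mkContinuous_norm_le _ zero_le_one _

/-- If `T = I + V` is a lower triangular Volterra operator such that `T S` is upper triangular,
then `S⁻¹ = T* T`. -/
theorem inverse_eq_of_upper (hk : Continuous (Function.uncurry k))
    (hsymm : ∀ x t, (k x t)ᴴ = k t x) (hl : 0 < l)
    (hS : IsOneSubKernel k l S) {D : ℝ} (hD : 0 ≤ D) (hV : VolterraBounded D (T - 1))
    (hup : ∀ a, (1 - trunc n l a) * (T * S) * trunc n l a = 0) :
    Ring.inverse S = ContinuousLinearMap.adjoint T * T := by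
  rw [← ContinuousLinearMap.star_eq_adjoint]
  set V := T - 1 with hVdef
  have hTV : T = 1 + V := by rw [hVdef, add_sub_cancel]
  obtain ⟨C₁, hC₁, hVb⟩ := hV.exists_bound hD hl.le
  obtain ⟨C₂, hC₂, hKb⟩ := hS.exists_bound hk hl.le
  have hSs : star S = S := hS.adjoint_eq hk hsymm hl.le
  have hPs : ∀ a, star (trunc n l a) = trunc n l a := adjoint_trunc
  have hTl : ∀ a, trunc n l a * T * (1 - trunc n l a) = 0 := by
    intro a
    have h := hV.lower a
    have h2 : trunc n l a * (1 - trunc n l a) = 0 := by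
      rw [mul_sub, trunc_mul_trunc, min_self, mul_one, sub_self]
    rw [hTV, mul_add, add_mul, h, mul_one, h2, add_zero]
  have hTs : ∀ a, (1 - trunc n l a) * star T * trunc n l a = 0 := by
    intro a
    have h := congrArg star (hTl a)
    simpa [hPs, mul_assoc] using h
  set A := T * S * star T - 1 with hA
  have hAs : star A = A := by
    rw [hA, star_sub, star_mul, star_mul, star_star, star_one, hSs, mul_assoc]
  have hAup : ∀ a, (1 - trunc n l a) * A * trunc n l a = 0 := by
    intro a
    set P := trunc n l a with hP
    have h1 : star T * P = P * (star T * P) := by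
      have := hTs a
      rw [sub_mul, sub_mul, one_mul, sub_eq_zero, mul_assoc] at this
      exact this
    have h2 : (1 - P) * P = 0 := by
      rw [sub_mul, one_mul, hP, trunc_mul_trunc, min_self, sub_self]
    calc (1 - P) * A * P = (1 - P) * (T * S) * (star T * P) - (1 - P) * P := by
          rw [hA]; noncomm_ring
      _ = (1 - P) * (T * S) * P * (star T * P) - 0 := by
          rw [h2, mul_assoc _ P, ← h1]
      _ = 0 := by rw [hup a, zero_mul, sub_zero]
  -- Taking adjoints of (1 - P) A P = 0 gives P A (1 - P) = 0, as A is self-adjoint; hence P A = P A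
  -- P = A P.
  have hAcomm : ∀ a, Commute (trunc n l a) A := by
    intro a
    have h1 := hAup a
    have h2 := congrArg star h1
    simp only [star_mul, star_sub, star_one, hPs, hAs, star_zero] at h2
    rw [sub_mul, sub_mul, one_mul, sub_eq_zero] at h1
    rw [mul_sub, mul_one, mul_sub, sub_eq_zero, ← mul_assoc] at h2
    exact h2.trans h1.symm
  have hA0 : A = 0 := by
    refine eq_zero_of_commute_trunc hl hAcomm
      (C := C₁ * (‖S * star T‖ * 2) + C₂ * (‖star T‖ * 2) + 2 * C₁) (by positivity) ?_
    intro a b hab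
    set R := trunc n l b - trunc n l a with hR
    have hR2 : ‖R‖ ≤ 2 := by
      refine (norm_sub_le _ _).trans ?_
      linarith [norm_trunc_le (n := n) (l := l) a, norm_trunc_le (n := n) (l := l) b]
    have hRs : star R = R := by rw [hR, star_sub, hPs, hPs]
    have h1 : ‖R * V‖ ≤ C₁ * √(b - a) := norm_trunc_sub_le hC₁ hVb hab
    have h2 : ‖R * (1 - S)‖ ≤ C₂ * √(b - a) := norm_trunc_sub_le hC₂ hKb hab
    have h3 : ‖star V * R‖ ≤ C₁ * √(b - a) := by
      rw [← norm_star, star_mul, star_star, hRs]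
      exact h1
    -- This expands A = V S T* - (1 - S) T* + V*. In each term a factor from L² to L^∞, or the
    -- adjoint of one, meets the projection R, so each is O(√(b - a)).
    have hdec : R * A * R = R * V * (S * star T * R) - R * (1 - S) * (star T * R)
        + R * (star V * R) := by
      rw [hA, show star V = star T - 1 by rw [hVdef, star_sub, star_one], hTV]
      noncomm_ring
    have hs0 := Real.sqrt_nonneg (b - a)
    have e1 : ‖R * V * (S * star T * R)‖ ≤ C₁ * √(b - a) * (‖S * star T‖ * 2) := by
      refine (norm_mul_le _ _).trans (mul_le_mul h1 ?_ (norm_nonneg _) (by positivity))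
      exact (norm_mul_le _ _).trans (mul_le_mul_of_nonneg_left hR2 (norm_nonneg _))
    have e2 : ‖R * (1 - S) * (star T * R)‖ ≤ C₂ * √(b - a) * (‖star T‖ * 2) := by
      refine (norm_mul_le _ _).trans (mul_le_mul h2 ?_ (norm_nonneg _) (by positivity))
      exact (norm_mul_le _ _).trans (mul_le_mul_of_nonneg_left hR2 (norm_nonneg _))
    have e3 : ‖R * (star V * R)‖ ≤ 2 * (C₁ * √(b - a)) :=
      (norm_mul_le _ _).trans (mul_le_mul hR2 h3 (norm_nonneg _) (by norm_num))
    rw [hdec]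
    refine (norm_add_le _ _).trans ((add_le_add ((norm_sub_le _ _).trans
      (add_le_add e1 e2)) e3).trans (le_of_eq ?_))
    ring
  have hT : IsUnit T := hTV ▸ hV.isUnit_one_add hD hl.le
  rw [hA, sub_eq_zero] at hA0
  have h1 : S * (star T * T) = 1 := by
    refine hT.mul_left_cancel ?_
    rw [mul_one, ← mul_assoc, ← mul_assoc, hA0, one_mul]
  have h2 : (star T * T) * S = 1 := by
    have := congrArg star h1
    rwa [star_mul, star_mul, star_star, hSs, star_one] at this
  exact Ring.inverse_unit ⟨S, star T * T, h1, h2⟩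

end Factorization

/-! ### The resolvent equation and its continuous dependence on x -/

section Resolvent

variable {n : ℕ} {k : ℝ → ℝ → Matrix (Fin n) (Fin n) ℂ}

theorem exists_L2_of_continuousOn {x : ℝ} {g : ℝ → EuclideanSpace ℂ (Fin n)}
    (hg : ContinuousOn g (Icc 0 x)) :
    ∃ G : L2 n x, G =ᵐ[volume.restrict (Ioo (0 : ℝ) x)] g := by
  obtain ⟨C, hC⟩ := isCompact_Icc.exists_bound_of_continuousOn hg
  have hGmem : MemLp g 2 (volume.restrict (Ioo (0 : ℝ) x)) := by
    refine MemLp.of_bound (C := C) ((hg.mono Ioo_subset_Icc_self).aestronglyMeasurable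
      measurableSet_Ioo) ?_
    filter_upwards [ae_restrict_mem measurableSet_Ioo] with t ht
    exact hC t (Ioo_subset_Icc_self ht)
  exact ⟨hGmem.toLp _, hGmem.coeFn_toLp⟩

theorem intervalIntegral_act_congr {x : ℝ} (hx : 0 ≤ x) {f g : ℝ → EuclideanSpace ℂ (Fin n)}
    (h : f =ᵐ[volume.restrict (Ioo (0 : ℝ) x)] g) (K : ℝ → Matrix (Fin n) (Fin n) ℂ) :
    ∫ r in (0 : ℝ)..x, act (K r) (f r) = ∫ r in (0 : ℝ)..x, act (K r) (g r) := by
  rw [← integral_restrict_Ioo_eq hx, ← integral_restrict_Ioo_eq hx]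
  refine integral_congr_ae ?_
  filter_upwards [h] with r hr
  rw [hr]

/-- The homogeneous equation has only the trivial continuous solution. -/
theorem eq_zero_of_homogeneous {x : ℝ} (hx : 0 < x) {S : L2 n x →L[ℂ] L2 n x} (hSu : IsUnit S)
    (hS : IsOneSubKernel k x S) {g : ℝ → EuclideanSpace ℂ (Fin n)}
    (hg : ContinuousOn g (Icc 0 x))
    (heq : ∀ t ∈ Icc 0 x, g t = ∫ r in (0 : ℝ)..x, act (k t r) (g r)) :
    g =ᵐ[volume.restrict (Ioo (0 : ℝ) x)] 0 := by
  obtain ⟨G, hG⟩ := exists_L2_of_continuousOn hg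
  have h0 : S G = 0 := by
    apply Lp.ext
    filter_upwards [hS G, hG, ae_restrict_mem measurableSet_Ioo,
      Lp.coeFn_zero (EuclideanSpace ℂ (Fin n)) 2 (volume.restrict (Ioo (0 : ℝ) x))]
      with t h1 h2 ht h0
    rw [h1, h2, h0, intervalIntegral_act_congr hx.le hG, ← heq t (Ioo_subset_Icc_self ht), sub_self]
    rfl
  have hG0 : G = 0 := by
    have h1 : (Ring.inverse S * S) G = 0 := by
      rw [mul_apply_eq_comp, h0, map_zero]
    rwa [Ring.inverse_mul_cancel _ hSu] at h1
  rw [hG0] at hG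
  exact hG.symm.trans (Lp.coeFn_zero _ _ _)

/-- The variable t ranges over all of [0,L] while only the upper limit x moves. All the operators
thus act on one fixed Banach space, where their dependence on x is Lipschitz in operator norm. -/
theorem exists_integralOp_continuousMap (hk : Continuous (Function.uncurry k)) {L : ℝ}
    (hL : 0 ≤ L) : ∃ B : Icc 0 L →
      (C(Icc 0 L, EuclideanSpace ℂ (Fin n)) →L[ℂ] C(Icc 0 L, EuclideanSpace ℂ (Fin n))),
      Continuous B ∧ ∀ x g t,
        B x g t = ∫ r in (0 : ℝ)..x, act (k t r) (IccExtend hL g r) := by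
  obtain ⟨D, hD, hDk⟩ := exists_norm_act_le
    (isCompact_Icc.prod isCompact_Icc : IsCompact (Icc 0 L ×ˢ Icc 0 L)) hk.continuousOn
  have hgc : ∀ g : C(Icc 0 L, EuclideanSpace ℂ (Fin n)), Continuous (IccExtend hL g) := fun g =>
    g.continuous.Icc_extend'
  have hint : ∀ (g : C(Icc 0 L, EuclideanSpace ℂ (Fin n))) (t a b : ℝ),
      IntervalIntegrable (fun r => act (k t r) (IccExtend hL g r)) volume a b := fun g t a b =>
    (continuous_act (hk.comp (Continuous.prodMk_right t)) (hgc g)).intervalIntegrable _ _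
  have hbd : ∀ (g : C(Icc 0 L, EuclideanSpace ℂ (Fin n))) (t x y : Icc 0 L),
      ‖∫ r in (y : ℝ)..x, act (k t r) (IccExtend hL g r)‖ ≤ D * |(x : ℝ) - y| * ‖g‖ := by
    intro g t x y
    have := intervalIntegral.norm_integral_le_of_norm_le_const (a := (y : ℝ)) (b := x)
      (f := fun r => act (k t r) (IccExtend hL g r)) (C := D * ‖g‖) (by
        intro r hr
        have hr' : r ∈ Icc 0 L := by
          have h := uIoc_subset_uIcc hr
          exact (uIcc_subset_Icc y.2 x.2) h
        refine (hDk (t, r) ⟨t.2, hr'⟩ _).trans (mul_le_mul_of_nonneg_left ?_ hD)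
        exact g.norm_coe_le_norm _)
    refine this.trans (le_of_eq (by ring))
  let B₀ : Icc 0 L →
      (C(Icc 0 L, EuclideanSpace ℂ (Fin n)) →ₗ[ℂ] C(Icc 0 L, EuclideanSpace ℂ (Fin n))) := fun x =>
    { toFun := fun g => ⟨fun t => ∫ r in (0 : ℝ)..x, act (k t r) (IccExtend hL g r), by
        refine intervalIntegral.continuous_parametric_intervalIntegral_of_continuous' ?_ _ _
        refine continuous_act (K := fun p : Icc 0 L × ℝ => k p.1 p.2) ?_
          ((hgc g).comp continuous_snd)
        exact hk.comp (f := fun p : Icc 0 L × ℝ => ((p.1 : ℝ), p.2)) (by fun_prop)⟩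
      map_add' := by
        intro g h
        ext1 t
        simp only [ContinuousMap.coe_mk, ContinuousMap.add_apply]
        rw [← intervalIntegral.integral_add (hint g t _ _) (hint h t _ _)]
        simp only [IccExtend, Function.comp_apply, ContinuousMap.add_apply, act, map_add]
      map_smul' := by
        intro c g
        ext1 t
        simp only [ContinuousMap.coe_mk, ContinuousMap.smul_apply, RingHom.id_apply]
        rw [← intervalIntegral.integral_smul]
        simp only [IccExtend, Function.comp_apply, ContinuousMap.smul_apply, act, map_smul] }
  have hB₀ : ∀ x g t, B₀ x g t = ∫ r in (0 : ℝ)..x, act (k t r) (IccExtend hL g r) :=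
    fun x g t => rfl
  have h0 : (0 : ℝ) ∈ Icc 0 L := ⟨le_rfl, hL⟩
  let B : Icc 0 L →
      (C(Icc 0 L, EuclideanSpace ℂ (Fin n)) →L[ℂ] C(Icc 0 L, EuclideanSpace ℂ (Fin n))) := fun x =>
    (B₀ x).mkContinuous (D * |(x : ℝ) - (0 : ℝ)|) fun g => by
      rw [ContinuousMap.norm_le _ (by positivity)]
      exact fun t => hbd g t x ⟨0, h0⟩
  refine ⟨B, ?_, hB₀⟩
  suffices h : LipschitzWith D.toNNReal B from h.continuous
  refine LipschitzWith.of_dist_le_mul fun x y => ?_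
  rw [dist_eq_norm, Real.coe_toNNReal _ hD, Subtype.dist_eq, Real.dist_eq]
  refine ContinuousLinearMap.opNorm_le_bound _ (by positivity) fun g => ?_
  rw [ContinuousMap.norm_le _ (by positivity)]
  intro t
  rw [_root_.sub_apply, ContinuousMap.sub_apply]
  change ‖B₀ x g t - B₀ y g t‖ ≤ _
  rw [hB₀, hB₀, intervalIntegral.integral_interval_sub_left (hint g t _ _) (hint g t _ _)]
  exact hbd g t x y

/-- Used to upgrade L² solutions on (0,x) to continuous functions on [0,L]. -/
theorem continuous_integral_act (hk : Continuous (Function.uncurry k)) {x L : ℝ} (hx : 0 ≤ x)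
    (hL : x ≤ L) (f : L2 n x) :
    Continuous fun t : Icc 0 L => ∫ r in (0 : ℝ)..x, act (k t r) (f r) := by
  obtain ⟨D, hD, hDk⟩ := exists_norm_act_le
    (isCompact_Icc.prod isCompact_Icc : IsCompact (Icc 0 L ×ˢ Icc 0 L)) hk.continuousOn
  have hxI : x ∈ Icc 0 x := ⟨hx, le_rfl⟩
  refine intervalIntegral.continuous_of_dominated_interval (bound := fun r => D * ‖f r‖)
    (fun t => ?_) (fun t => ?_) ((intervalIntegrable_norm_L2 f hxI).const_mul D) ?_
  · exact (intervalIntegrable_iff.1 (intervalIntegrable_act (K := k t) hxI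
      (hk.comp (Continuous.prodMk_right (t : ℝ))).continuousOn f)).1
  · refine Filter.Eventually.of_forall fun r hr => hDk (t, r) ⟨t.2, ?_⟩ _
    rw [uIoc_of_le hx] at hr
    exact ⟨hr.1.le, hr.2.trans hL⟩
  · refine Filter.Eventually.of_forall fun r _ => continuous_act ?_ continuous_const
    exact hk.comp (f := fun t : Icc 0 L => ((t : ℝ), r)) (by fun_prop)

/-- B g depends only on g restricted to [0,x]. For injectivity, that restriction lies in the kernel
of S, so it vanishes almost everywhere and g = B g = 0. For surjectivity, solve S f = b on (0,x) and
put g(t) = b(t) + ∫₀ˣ k(t,r) f(r) dr on all of [0,L]; it agrees with f on (0,x). -/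
theorem isUnit_one_sub_of_isUnit (hk : Continuous (Function.uncurry k)) {L : ℝ} (hL : 0 ≤ L)
    {x : Icc 0 L} (hx : 0 < (x : ℝ)) {S : L2 n x →L[ℂ] L2 n x} (hSu : IsUnit S)
    (hS : IsOneSubKernel k x S)
    {B : C(Icc 0 L, EuclideanSpace ℂ (Fin n)) →L[ℂ] C(Icc 0 L, EuclideanSpace ℂ (Fin n))}
    (hB : ∀ g t, B g t = ∫ r in (0 : ℝ)..x, act (k t r) (IccExtend hL g r)) :
    IsUnit (1 - B) := by
  have hgc : ∀ g : C(Icc 0 L, EuclideanSpace ℂ (Fin n)), Continuous (IccExtend hL g) := fun g =>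
    g.continuous.Icc_extend'
  rw [ContinuousLinearMap.isUnit_iff_bijective]
  constructor
  · rw [injective_iff_map_eq_zero]
    intro g hg
    rw [_root_.sub_apply, one_apply_eq_self, sub_eq_zero] at hg
    have h1 : ∀ t : Icc 0 L, g t = ∫ r in (0 : ℝ)..x, act (k t r) (IccExtend hL g r) := by
      intro t
      rw [← hB, ← hg]
    have h2 := eq_zero_of_homogeneous hx hSu hS (hgc g).continuousOn (fun t ht => by
      have htL : t ∈ Icc 0 L := ⟨ht.1, ht.2.trans x.2.2⟩
      rw [IccExtend_of_mem hL _ htL]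
      exact h1 ⟨t, htL⟩)
    ext1 t
    rw [h1, intervalIntegral_act_congr hx.le h2]
    simp [act]
  · intro b
    obtain ⟨b', hb'⟩ := exists_L2_of_continuousOn (x := x) (hgc b).continuousOn
    set f := Ring.inverse S b' with hf
    have hSf : S f = b' := by
      rw [hf, ← mul_apply_eq_comp, Ring.mul_inverse_cancel _ hSu, one_apply_eq_self]
    set g : C(Icc 0 L, EuclideanSpace ℂ (Fin n)) :=
      b + ⟨_, continuous_integral_act hk hx.le x.2.2 f⟩ with hg
    have hgt : ∀ t, g t = b t + ∫ r in (0 : ℝ)..x, act (k t r) (f r) := fun t => rfl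
    have hfg : f =ᵐ[volume.restrict (Ioo (0 : ℝ) x)] IccExtend hL g := by
      filter_upwards [hS f, hb', ae_restrict_mem measurableSet_Ioo] with t h1 h2 ht
      have htL : t ∈ Icc 0 L := ⟨ht.1.le, ht.2.le.trans x.2.2⟩
      rw [IccExtend_of_mem hL _ htL, hgt]
      rw [hSf, h2, IccExtend_of_mem hL _ htL] at h1
      rw [h1, sub_add_cancel]
    refine ⟨g, ?_⟩
    ext1 t
    rw [_root_.sub_apply, one_apply_eq_self, ContinuousMap.sub_apply, hB,
      ← intervalIntegral_act_congr hx.le hfg, hgt, add_sub_cancel_right]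

theorem continuous_inverse_one_sub {R X : Type*} [NormedRing R] [HasSummableGeomSeries R]
    [TopologicalSpace X] {B : X → R} (hB : Continuous B) (hu : ∀ x, IsUnit (1 - B x)) :
    Continuous fun x => Ring.inverse (1 - B x) :=
  continuous_iff_continuousAt.2 fun x => ContinuousAt.comp (f := fun x => 1 - B x)
    (NormedRing.inverse_continuousAt (hu x).unit) (continuous_const.sub hB).continuousAt

/-- Solutions of the resolvent equation depend continuously on the length of the interval. -/
theorem exists_resolvent_on_Icc (hk : Continuous (Function.uncurry k))
    (hS : ∀ l : ℝ, 0 < l → ∃ S : L2 n l →L[ℂ] L2 n l, IsUnit S ∧ IsOneSubKernel k l S)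
    {L : ℝ} (hL : 0 ≤ L) : ∃ g : ℝ → Fin n → ℝ → EuclideanSpace ℂ (Fin n),
      (∀ j, Continuous fun p : ℝ × ℝ => g p.1 j p.2) ∧
      ∀ x ∈ Icc 0 L, ∀ j, ∀ t ∈ Icc 0 L,
        g x j t - ∫ r in (0 : ℝ)..x, act (k t r) (g x j r) =
          act (k t x) (EuclideanSpace.single j 1) := by
  obtain ⟨B, hBc, hB⟩ := exists_integralOp_continuousMap hk hL
  have hu : ∀ x, IsUnit (1 - B x) := by
    intro x
    -- No operator S is given on the degenerate interval x = 0, but there B x = 0.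
    rcases eq_or_lt_of_le x.2.1 with h0 | h0
    · have : 1 - B x = 1 := by
        ext1 g
        ext1 t
        rw [_root_.sub_apply, ContinuousMap.sub_apply, hB, ← h0, intervalIntegral.integral_same,
          sub_zero]
      rw [this]
      exact isUnit_one
    · obtain ⟨S, hSu, hSk⟩ := hS x h0
      exact isUnit_one_sub_of_isUnit hk hL h0 hSu hSk (hB x)
  have hinv : Continuous fun x => Ring.inverse (1 - B x) :=
    continuous_inverse_one_sub
      (R := C(Icc 0 L, EuclideanSpace ℂ (Fin n)) →L[ℂ] C(Icc 0 L, EuclideanSpace ℂ (Fin n))) hBc hu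
  let b : Fin n → C(Icc 0 L, C(Icc 0 L, EuclideanSpace ℂ (Fin n))) := fun j =>
    ContinuousMap.curry ⟨fun p : Icc 0 L × Icc 0 L =>
      act (k p.2 p.1) (EuclideanSpace.single j 1), by
        refine continuous_act (K := fun p : Icc 0 L × Icc 0 L => k p.2 p.1) ?_ continuous_const
        exact hk.comp (f := fun p : Icc 0 L × Icc 0 L => ((p.2 : ℝ), (p.1 : ℝ))) (by fun_prop)⟩
  let e : Fin n → Icc 0 L → C(Icc 0 L, EuclideanSpace ℂ (Fin n)) := fun j x =>
    Ring.inverse (1 - B x) (b j x)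
  have he : ∀ j, Continuous (e j) := fun j => hinv.clm_apply (b j).continuous
  have heq : ∀ j x, e j x - B x (e j x) = b j x := by
    intro j x
    have : (1 - B x) (e j x) = b j x := by
      rw [← mul_apply_eq_comp, Ring.mul_inverse_cancel _ (hu x), one_apply_eq_self]
    rwa [_root_.sub_apply, one_apply_eq_self] at this
  refine ⟨fun x j t => e j (projIcc 0 L hL x) (projIcc 0 L hL t), fun j => ?_, ?_⟩
  · have h1 : Continuous fun p : ℝ × ℝ => e j (projIcc 0 L hL p.1) :=
      (he j).comp (continuous_projIcc.comp continuous_fst)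
    have h2 : Continuous fun p : ℝ × ℝ => projIcc 0 L hL p.2 :=
      continuous_projIcc.comp continuous_snd
    exact h1.eval h2
  · intro x hx j t ht
    have h := congrArg (fun u : C(Icc 0 L, EuclideanSpace ℂ (Fin n)) => u ⟨t, ht⟩) (heq j ⟨x, hx⟩)
    simp only [ContinuousMap.sub_apply, hB] at h
    simp only [projIcc_of_mem hL hx, projIcc_of_mem hL ht]
    exact h

/-- The solutions built for different L agree on 0 ≤ t ≤ x by uniqueness, so they patch to one
function on the unbounded triangle. -/
theorem exists_resolvent (hk : Continuous (Function.uncurry k))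
    (hS : ∀ l : ℝ, 0 < l → ∃ S : L2 n l →L[ℂ] L2 n l, IsUnit S ∧ IsOneSubKernel k l S) :
    ∃ g : ℝ → Fin n → ℝ → EuclideanSpace ℂ (Fin n),
      (∀ j, ContinuousOn (fun p : ℝ × ℝ => g p.1 j p.2) {p | 0 ≤ p.2 ∧ p.2 ≤ p.1}) ∧
      ∀ x, 0 ≤ x → ∀ j, ∀ t ∈ Icc 0 x,
        g x j t - ∫ r in (0 : ℝ)..x, act (k t r) (g x j r) =
          act (k t x) (EuclideanSpace.single j 1) := by
  have h := fun L : {L : ℝ // 0 ≤ L} => exists_resolvent_on_Icc hk hS L.2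
  choose G hGc hG using h
  have huniq : ∀ L L' : {L : ℝ // 0 ≤ L}, ∀ x : ℝ, 0 ≤ x → x ≤ L → x ≤ L' → ∀ j, ∀ t ∈ Icc 0 x,
      G L x j t = G L' x j t := by
    intro L L' x hx hxL hxL' j t ht
    have hrow : ∀ L : {L : ℝ // 0 ≤ L}, Continuous (G L x j) := fun L =>
      (hGc L j).comp (Continuous.prodMk_right x)
    have hkrow : ∀ t, Continuous (k t) := fun t => hk.comp (Continuous.prodMk_right t)
    have hdiff : ∀ t ∈ Icc 0 x, G L x j t - G L' x j t =
        ∫ r in (0 : ℝ)..x, act (k t r) (G L x j r - G L' x j r) := by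
      intro t ht
      have h1 := hG L x ⟨hx, hxL⟩ j t ⟨ht.1, ht.2.trans hxL⟩
      have h2 := hG L' x ⟨hx, hxL'⟩ j t ⟨ht.1, ht.2.trans hxL'⟩
      simp only [act, map_sub]
      rw [intervalIntegral.integral_sub
        ((continuous_act (hkrow t) (hrow L)).intervalIntegrable _ _)
        ((continuous_act (hkrow t) (hrow L')).intervalIntegrable _ _), ← sub_eq_zero,
        ← sub_eq_zero.2 (h1.trans h2.symm)]
      abel
    rw [← sub_eq_zero, hdiff t ht]
    rcases eq_or_lt_of_le hx with h0 | h0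
    · rw [← h0, intervalIntegral.integral_same]
    · obtain ⟨S, hSu, hSk⟩ := hS x h0
      have := eq_zero_of_homogeneous h0 hSu hSk ((hrow L).sub (hrow L')).continuousOn hdiff
      have h3 := intervalIntegral_act_congr hx this (k t)
      simp only [Pi.sub_apply] at h3
      rw [h3]
      simp [act]
  -- The margin 1 makes the solution for `M x₀` valid for every x < x₀ + 1, so near x₀ the patched
  -- function equals a single continuous one.
  let M : ℝ → {L : ℝ // 0 ≤ L} := fun x => ⟨|x| + 1, by positivity⟩
  refine ⟨fun x j t => G (M x) x j t, fun j => ?_, ?_⟩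
  · rintro ⟨x₀, t₀⟩ ⟨h1, h2⟩
    simp only at h1 h2
    have hx₀ : 0 ≤ x₀ := h1.trans h2
    have hc : ContinuousWithinAt (fun p : ℝ × ℝ => G (M x₀) p.1 j p.2)
        {p | 0 ≤ p.2 ∧ p.2 ≤ p.1} (x₀, t₀) := (hGc (M x₀) j).continuousWithinAt
    refine hc.congr_of_eventuallyEq ?_ rfl
    have hn : {p : ℝ × ℝ | p.1 < x₀ + 1} ∈ nhds (x₀, t₀) :=
      (isOpen_lt continuous_fst continuous_const).mem_nhds (by simp)
    filter_upwards [self_mem_nhdsWithin, mem_nhdsWithin_of_mem_nhds hn] with p hp hpx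
    have hp1 : 0 ≤ p.1 := hp.1.trans hp.2
    have hpx' : p.1 < x₀ + 1 := hpx
    refine huniq _ _ p.1 hp1 ?_ ?_ j p.2 hp
    · exact (le_abs_self _).trans (by simp [M])
    · simp only [M, abs_of_nonneg hx₀]
      exact hpx'.le
  · intro x hx j t ht
    have hxM : x ≤ M x := (le_abs_self _).trans (by simp [M])
    exact hG (M x) x ⟨hx, hxM⟩ j t ⟨ht.1, ht.2.trans hxM⟩

end Resolvent

/-! ### Continuity and symmetry of the kernel s when Φ(0) = 0 -/

section KernelContinuity

/-- Truncated correlations of square integrable functions are continuous, as translations are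
continuous on `L²`. -/
theorem continuous_correlation {f g : ℝ → ℂ} (hf : MemLp f 2 volume) (hg : MemLp g 2 volume) :
    Continuous fun p : ℝ × ℝ => ∫ ζ in Ioi (0 : ℝ), f (p.1 - ζ) * star (g (p.2 - ζ)) := by
  have hmp : ∀ x : ℝ, MeasurePreserving (fun ζ : ℝ => x - ζ) volume volume := fun x =>
    Measure.measurePreserving_sub_left volume x
  -- The reflected translations ζ ↦ x - ζ form a continuous family of measure preserving maps, so
  -- composing a fixed L² function with them is continuous in x.
  let c : C(ℝ, C(ℝ, ℝ)) := ContinuousMap.curry ⟨fun p : ℝ × ℝ => p.1 - p.2, by fun_prop⟩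
  have htrans : ∀ {f : ℝ → ℂ} (hf : MemLp f 2 volume), ∃ F : ℝ → Lp ℂ 2 (volume.restrict (Ioi 0)),
      Continuous F ∧ ∀ x, F x =ᵐ[volume.restrict (Ioi (0 : ℝ))] fun ζ => f (x - ζ) := by
    intro f hf
    refine ⟨fun x => LpToLpRestrictCLM ℝ ℂ ℂ volume 2 (Ioi 0)
      (Lp.compMeasurePreserving (c x) (hmp x) (hf.toLp f)), ?_, fun x => ?_⟩
    · exact (ContinuousLinearMap.continuous _).comp
        (continuous_const.compMeasurePreservingLp c.continuous (fun x => hmp x) (by norm_num))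
    · refine (LpToLpRestrictCLM_coeFn ℂ _ _).trans (ae_restrict_of_ae ?_)
      refine (Lp.coeFn_compMeasurePreserving _ (hmp x)).trans ?_
      exact (hmp x).quasiMeasurePreserving.ae_eq_comp hf.coeFn_toLp
  obtain ⟨F, hFc, hF⟩ := htrans hf
  obtain ⟨G, hGc, hG⟩ := htrans hg
  have : (fun p : ℝ × ℝ => ∫ ζ in Ioi (0 : ℝ), f (p.1 - ζ) * star (g (p.2 - ζ))) =
      fun p => inner ℂ (G p.2) (F p.1) := by
    ext p
    rw [L2.inner_def]
    refine integral_congr_ae ?_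
    filter_upwards [hF p.1, hG p.2] with ζ h1 h2
    rw [h1, h2, RCLike.inner_apply]
    rfl
  rw [this]
  exact (hGc.comp continuous_snd).inner (hFc.comp continuous_fst)

variable {m n : ℕ} {Φ : ℝ → Matrix (Fin m) (Fin n) ℂ}

theorem sKernel_apply (hΦ0 : Φ 0 = 0) (x t : ℝ) (i j : Fin m) :
    sKernel Φ x t i j =
      ∫ ζ in (0 : ℝ)..min x t, ∑ q, dmat Φ (x - ζ) i q * star (dmat Φ (t - ζ) j q) := by
  simp only [sKernel, hΦ0, conjTranspose_zero, Matrix.mul_zero, Matrix.zero_mul, ite_self,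
    Matrix.add_apply, Matrix.zero_apply, add_zero, of_apply]
  rfl

theorem conjTranspose_sKernel (hΦ0 : Φ 0 = 0) (x t : ℝ) : (sKernel Φ x t)ᴴ = sKernel Φ t x := by
  ext i j
  rw [conjTranspose_apply, sKernel_apply hΦ0, sKernel_apply hΦ0, min_comm t x]
  change (starRingEnd ℂ) _ = _
  rw [intervalIntegral.intervalIntegral_eq_integral_uIoc,
    intervalIntegral.intervalIntegral_eq_integral_uIoc, Complex.real_smul, Complex.real_smul,
    map_mul, Complex.conj_ofReal, ← integral_conj]
  simp [mul_comm]

/-- On a bounded square the kernel is a finite sum of truncated correlations. -/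
theorem sKernel_eq_sum_correlation (hΦ0 : Φ 0 = 0) {L : ℝ}
    {x t : ℝ} (hx : x ∈ Ico 0 L) (ht : t ∈ Ico 0 L) (i j : Fin m)
    (hmem : ∀ i q, MemLp ((Ioo 0 L).indicator fun y => dmat Φ y i q) 2 volume) :
    sKernel Φ x t i j = ∑ q, ∫ ζ in Ioi (0 : ℝ), (Ioo 0 L).indicator (fun y => dmat Φ y i q) (x - ζ) *
      star ((Ioo 0 L).indicator (fun y => dmat Φ y j q) (t - ζ)) := by
  have hmp : ∀ x : ℝ, MeasurePreserving (fun ζ : ℝ => x - ζ) volume volume := fun x =>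
    Measure.measurePreserving_sub_left volume x
  rw [← integral_finsetSum]
  · rw [sKernel_apply hΦ0, intervalIntegral.integral_of_le (le_min hx.1 ht.1),
      integral_Ioc_eq_integral_Ioo,
      ← inter_eq_right.2 (Ioo_subset_Ioi_self : Ioo 0 (min x t) ⊆ Ioi 0),
      ← setIntegral_indicator measurableSet_Ioo]
    refine setIntegral_congr_fun measurableSet_Ioi fun ζ hζ => ?_
    have hζ0 : 0 < ζ := hζ
    by_cases h : ζ < min x t
    · have h1 := h.trans_le (min_le_left _ _)
      have h2 := h.trans_le (min_le_right _ _)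
      rw [indicator_of_mem (show ζ ∈ Ioo 0 (min x t) from ⟨hζ0, h⟩)]
      refine Finset.sum_congr rfl fun q _ => ?_
      rw [indicator_of_mem (show x - ζ ∈ Ioo 0 L from ⟨by linarith, by linarith [hx.2]⟩),
        indicator_of_mem (show t - ζ ∈ Ioo 0 L from ⟨by linarith, by linarith [ht.2]⟩)]
    · rw [indicator_of_notMem (fun h' : ζ ∈ Ioo 0 (min x t) => h h'.2)]
      symm
      refine Finset.sum_eq_zero fun q _ => ?_
      rcases min_le_iff.1 (not_lt.1 h) with h' | h'
      · rw [indicator_of_notMem (fun hm : x - ζ ∈ Ioo 0 L => by linarith [hm.1]), zero_mul]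
      · rw [indicator_of_notMem (fun hm : t - ζ ∈ Ioo 0 L => by linarith [hm.1]), star_zero,
          mul_zero]
  · intro q _
    have h1 := (hmem i q).comp_measurePreserving (hmp x)
    have h2 := ((hmem j q).comp_measurePreserving (hmp t)).star
    exact (h1.integrable_mul h2).integrableOn

theorem memLp_indicator_dmat {L : ℝ} (hΦ : BoundedlyDifferentiable Φ L) (i : Fin m) (q : Fin n) :
    MemLp ((Ioo 0 L).indicator fun y => dmat Φ y i q) 2 volume := by
  obtain ⟨-, M, hM⟩ := hΦ
  rw [memLp_indicator_iff_restrict measurableSet_Ioo]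
  refine MemLp.of_bound (C := M) (measurable_dmat Φ i q).aestronglyMeasurable ?_
  filter_upwards [ae_restrict_mem measurableSet_Ioo] with y hy
  exact hM y hy i q

/-- The kernel extended continuously from the quadrant to the plane. -/
noncomputable def clampedKernel (Φ : ℝ → Matrix (Fin m) (Fin n) ℂ) (x t : ℝ) :
    Matrix (Fin m) (Fin m) ℂ := sKernel Φ (max x 0) (max t 0)

/-- Continuity is local: near a given point Φ' may be cut off to a bounded interval, where it is
bounded and hence in L², and `continuous_correlation` applies. No continuity of Φ' is used. -/
theorem continuous_clampedKernel (hΦ : ∀ l : ℝ, 0 < l → BoundedlyDifferentiable Φ l)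
    (hΦ0 : Φ 0 = 0) : Continuous (Function.uncurry (clampedKernel Φ)) := by
  refine continuous_pi fun i => continuous_pi fun j => continuous_iff_continuousAt.2 fun p₀ => ?_
  -- Adding 1 keeps both coordinates strictly below L throughout a neighbourhood of p₀.
  set L : ℝ := max (max p₀.1 p₀.2) 0 + 1 with hL
  have hL0 : 0 < L := by positivity
  have hmem := memLp_indicator_dmat (hΦ L hL0)
  have hc : Continuous fun p : ℝ × ℝ => ∑ q, ∫ ζ in Ioi (0 : ℝ),
      (Ioo 0 L).indicator (fun y => dmat Φ y i q) (max p.1 0 - ζ) *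
        star ((Ioo 0 L).indicator (fun y => dmat Φ y j q) (max p.2 0 - ζ)) := by
    refine continuous_finsetSum _ fun q _ => ?_
    exact (continuous_correlation (hmem i q) (hmem j q)).comp
      (f := fun p : ℝ × ℝ => (max p.1 0, max p.2 0)) (by fun_prop)
  refine hc.continuousAt.congr ?_
  have h1 : {p : ℝ × ℝ | p.1 < L} ∈ nhds p₀ :=
    (isOpen_lt continuous_fst continuous_const).mem_nhds (by
      change p₀.1 < L
      linarith [le_max_left p₀.1 p₀.2, le_max_left (max p₀.1 p₀.2) 0])
  have h2 : {p : ℝ × ℝ | p.2 < L} ∈ nhds p₀ :=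
    (isOpen_lt continuous_snd continuous_const).mem_nhds (by
      change p₀.2 < L
      linarith [le_max_right p₀.1 p₀.2, le_max_left (max p₀.1 p₀.2) 0])
  filter_upwards [h1, h2] with p hp1 hp2
  exact (sKernel_eq_sum_correlation hΦ0 ⟨le_max_right _ _, max_lt hp1 hL0⟩
    ⟨le_max_right _ _, max_lt hp2 hL0⟩ i j hmem).symm

theorem conjTranspose_clampedKernel (hΦ0 : Φ 0 = 0) (x t : ℝ) :
    (clampedKernel Φ x t)ᴴ = clampedKernel Φ t x :=
  conjTranspose_sKernel hΦ0 _ _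

theorem isOneSubKernel_structuredOp {l : ℝ} (hl : 0 < l) (hΦ : BoundedlyDifferentiable Φ l)
    (hΦ0 : Φ 0 = 0) : IsOneSubKernel (clampedKernel Φ) l (structuredOp Φ hl hΦ) := by
  intro f
  filter_upwards [structuredOp_spec Φ hl hΦ f, ae_restrict_mem measurableSet_Ioo] with x h1 hx
  rw [h1, hΦ0, Matrix.zero_mul, sub_zero, act_one]
  congr 1
  refine intervalIntegral.integral_congr fun t ht => ?_
  rw [uIcc_of_le hl.le] at ht
  simp only [clampedKernel, max_eq_left hx.1.le, max_eq_left ht.1]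

end KernelContinuity

/-! ### Uniqueness of the factor and of its kernel -/

section Uniqueness

variable {n : ℕ} {l : ℝ}

/-- Lower triangular Volterra factors with the same `T* T` coincide. -/
theorem volterra_factor_unique (hl : 0 < l) {T₁ T₂ : L2 n l →L[ℂ] L2 n l} {D₁ D₂ : ℝ}
    (hD₁ : 0 ≤ D₁) (hD₂ : 0 ≤ D₂) (h₁ : VolterraBounded D₁ (T₁ - 1))
    (h₂ : VolterraBounded D₂ (T₂ - 1)) (h : star T₁ * T₁ = star T₂ * T₂) : T₁ = T₂ := by
  have e₁ : 1 + (T₁ - 1) = T₁ := add_sub_cancel _ _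
  have e₂ : 1 + (T₂ - 1) = T₂ := add_sub_cancel _ _
  have hu₁ : IsUnit T₁ := e₁ ▸ h₁.isUnit_one_add hD₁ hl.le
  have hu₂ : IsUnit T₂ := e₂ ▸ h₂.isUnit_one_add hD₂ hl.le
  set R₁ := Ring.inverse T₁ with hR₁
  set R₂ := Ring.inverse T₂ with hR₂
  have hTR₁ : T₁ * R₁ = 1 := Ring.mul_inverse_cancel _ hu₁
  have hRT₁ : R₁ * T₁ = 1 := Ring.inverse_mul_cancel _ hu₁
  have hTR₂ : T₂ * R₂ = 1 := Ring.mul_inverse_cancel _ hu₂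
  have hPs : ∀ a, star (trunc n l a) = trunc n l a := adjoint_trunc
  have hPP : ∀ a, trunc n l a * trunc n l a = trunc n l a := fun a => by
    rw [trunc_mul_trunc, min_self]
  have hlow : ∀ {T : L2 n l →L[ℂ] L2 n l} {D : ℝ}, VolterraBounded D (T - 1) → ∀ a,
      trunc n l a * T = trunc n l a * T * trunc n l a := by
    intro T D hT a
    have h0 := hT.lower a
    have : trunc n l a * (T - 1) * (1 - trunc n l a) =
        trunc n l a * T - trunc n l a * T * trunc n l a -
          (trunc n l a - trunc n l a * trunc n l a) := by noncomm_ring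
    rw [this, hPP, sub_self, sub_zero, sub_eq_zero] at h0
    exact h0
  have hlowR : ∀ {T : L2 n l →L[ℂ] L2 n l} {D : ℝ}, 0 ≤ D → VolterraBounded D (T - 1) → ∀ a,
      trunc n l a * Ring.inverse T = trunc n l a * Ring.inverse T * trunc n l a := by
    intro T D hD hT a
    have h0 := hT.lower_inverse hD hl.le a
    rw [add_sub_cancel, mul_sub, mul_one, sub_eq_zero] at h0
    exact h0
  set Q := T₂ * R₁ with hQ
  have hQQ : star Q * Q = 1 := by
    calc star Q * Q = star R₁ * (star T₂ * T₂) * R₁ := by rw [hQ, star_mul]; noncomm_ring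
      _ = star (T₁ * R₁) * (T₁ * R₁) := by rw [← h, star_mul]; noncomm_ring
      _ = 1 := by rw [hTR₁, star_one, one_mul]
  have hQW : Q * (T₁ * R₂) = 1 := by
    rw [hQ, mul_assoc, ← mul_assoc R₁, hRT₁, one_mul, hTR₂]
  -- A left inverse and a right inverse of Q coincide; this exhibits Q* as a product of lower
  -- triangular operators.
  have hQs : star Q = T₁ * R₂ := by
    rw [← mul_one (star Q), ← hQW, ← mul_assoc, hQQ, one_mul]
  have hQlow : ∀ a, trunc n l a * Q = trunc n l a * Q * trunc n l a := by
    intro a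
    rw [hQ, ← mul_assoc, hlow h₂ a, mul_assoc _ (trunc n l a) R₁, hlowR hD₁ h₁ a]
    simp only [mul_assoc, hPP]
  have hQslow : ∀ a, trunc n l a * star Q = trunc n l a * star Q * trunc n l a := by
    intro a
    rw [hQs, ← mul_assoc, hlow h₁ a, mul_assoc _ (trunc n l a) R₂, hlowR hD₂ h₂ a]
    simp only [mul_assoc, hPP]
  have hcomm : ∀ a, Commute (trunc n l a) (Q - 1) := by
    intro a
    refine Commute.sub_right ?_ (Commute.one_right _)
    have h3 := congrArg star (hQslow a)
    simp only [star_mul, star_star, hPs] at h3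
    rw [← mul_assoc, ← hQlow a] at h3
    exact h3.symm
  obtain ⟨C₁, hC₁, hb₁⟩ := h₁.exists_bound hD₁ hl.le
  obtain ⟨C₂, hC₂, hb₂⟩ := h₂.exists_bound hD₂ hl.le
  -- The left factor is a difference of Volterra operators, bounded from L² to L^∞, which makes Q -
  -- 1 small on short intervals.
  have hQ1 : Q - 1 = ((T₂ - 1) - (T₁ - 1)) * R₁ := by
    rw [sub_sub_sub_cancel_right, sub_mul, hTR₁]
  have hz : Q - 1 = 0 := by
    refine eq_zero_of_commute_trunc hl hcomm (C := (C₂ + C₁) * (‖R₁‖ * 2)) (by positivity) ?_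
    intro a b hab
    set Z := trunc n l b - trunc n l a with hZ
    have hZ2 : ‖Z‖ ≤ 2 := by
      refine (norm_sub_le _ _).trans ?_
      linarith [norm_trunc_le (n := n) (l := l) a, norm_trunc_le (n := n) (l := l) b]
    have z1 : ‖Z * (T₁ - 1)‖ ≤ C₁ * √(b - a) := norm_trunc_sub_le hC₁ hb₁ hab
    have z2 : ‖Z * (T₂ - 1)‖ ≤ C₂ * √(b - a) := norm_trunc_sub_le hC₂ hb₂ hab
    have hdec : Z * (Q - 1) * Z = (Z * (T₂ - 1) - Z * (T₁ - 1)) * (R₁ * Z) := by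
      rw [hQ1]; noncomm_ring
    rw [hdec]
    refine (norm_mul_le _ _).trans ((mul_le_mul ((norm_sub_le _ _).trans (add_le_add z2 z1))
      ((norm_mul_le _ _).trans (mul_le_mul_of_nonneg_left hZ2 (norm_nonneg _)))
      (norm_nonneg _) (by positivity)).trans (le_of_eq ?_))
    ring
  have : Q * T₁ = T₁ := by rw [sub_eq_zero.1 hz, one_mul]
  rw [← this, hQ, mul_assoc, hRT₁, mul_one]

theorem triangle_subset_closure (hl : 0 < l) :
    triangle l ⊆ closure {p : ℝ × ℝ | 0 < p.2 ∧ p.2 < p.1 ∧ p.1 < l} := by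
  rintro ⟨x, t⟩ ⟨h1, h2, h3⟩
  simp only at h1 h2 h3
  -- The point is moved along the segment towards the interior point (2l/3, l/3); convexity keeps
  -- the segment inside the open triangle for 0 < s < 1.
  have hlim : Filter.Tendsto (fun s : ℝ => (x + s * (2 * l / 3 - x), t + s * (l / 3 - t)))
      (nhdsWithin 0 (Ioi 0)) (nhds (x, t)) := by
    have hc : Continuous fun s : ℝ => (x + s * (2 * l / 3 - x), t + s * (l / 3 - t)) := by fun_prop
    have := hc.tendsto 0
    simp only [zero_mul, add_zero] at this
    exact this.mono_left nhdsWithin_le_nhds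
  refine mem_closure_of_tendsto hlim ?_
  filter_upwards [Ioo_mem_nhdsGT (one_pos : (0 : ℝ) < 1)] with s hs
  obtain ⟨hs0, hs1⟩ := hs
  have p1 := mul_pos hs0 hl
  refine ⟨?_, ?_, ?_⟩
  · nlinarith
  · nlinarith
  · nlinarith

/-- A continuous Volterra kernel is determined by its operator. -/
theorem kernel_eqOn_of_isVolterra (hl : 0 < l) {E₁ E₂ : ℝ → ℝ → Matrix (Fin n) (Fin n) ℂ}
    (h₁ : ContinuousOn (Function.uncurry E₁) (triangle l))
    (h₂ : ContinuousOn (Function.uncurry E₂) (triangle l)) {T : L2 n l →L[ℂ] L2 n l}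
    (hT₁ : IsVolterra E₁ l T) (hT₂ : IsVolterra E₂ l T) :
    EqOn (Function.uncurry E₁) (Function.uncurry E₂) (triangle l) := by
  set U := {p : ℝ × ℝ | 0 < p.2 ∧ p.2 < p.1 ∧ p.1 < l} with hU
  have hUT : U ⊆ triangle l := fun p hp => ⟨hp.1.le, hp.2.1.le, hp.2.2.le⟩
  have hUo : IsOpen U := (isOpen_lt continuous_const continuous_snd).inter
    ((isOpen_lt continuous_snd continuous_fst).inter (isOpen_lt continuous_fst continuous_const))
  refine EqOn.of_subset_closure (s := U) ?_ h₁ h₂ hUT (triangle_subset_closure hl)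
  rintro ⟨x₀, t₀⟩ hp
  ext i j
  by_contra hne
  set d : ℝ × ℝ → ℂ := fun p => E₁ p.1 p.2 i j - E₂ p.1 p.2 i j with hd
  have hdc : ContinuousOn d (triangle l) :=
    (continuousOn_pi.1 (continuousOn_pi.1 h₁ i) j).sub (continuousOn_pi.1 (continuousOn_pi.1 h₂ i) j)
  set c : ℂ := d (x₀, t₀) with hc
  have hc0 : c ≠ 0 := sub_ne_zero.2 hne
  -- Multiplying the difference of entries by the conjugate of its value c at the base point makes
  -- its real part positive nearby, so its integral over a small interval cannot cancel.
  have hpos : 0 < (star c * c).re := by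
    have : star c * c = ((‖c‖ ^ 2 : ℝ) : ℂ) := by
      push_cast
      exact RCLike.conj_mul c
    rw [this, Complex.ofReal_re]
    have := norm_pos_iff.2 hc0
    positivity
  have hev : ∀ᶠ p in nhds (x₀, t₀), p ∈ U ∧ 0 < (star c * d p).re := by
    refine Filter.Eventually.and (hUo.eventually_mem hp) ?_
    have hcont : ContinuousAt (fun p => (star c * d p).re) (x₀, t₀) := by
      have := (hdc.continuousAt (Filter.mem_of_superset (hUo.mem_nhds hp) hUT))
      exact Complex.continuous_re.continuousAt.comp (continuousAt_const.mul this)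
    exact hcont.eventually (lt_mem_nhds hpos)
  rw [nhds_prod_eq] at hev
  obtain ⟨A, hA, B, hB, hAB⟩ := Filter.eventually_prod_iff.1 hev
  obtain ⟨ε, hε, hεA⟩ := Metric.eventually_nhds_iff_ball.1 hA
  obtain ⟨δ, hδ, hδB⟩ := Metric.eventually_nhds_iff_ball.1 hB
  rw [Real.ball_eq_Ioo] at hεA hδB
  -- Halving δ puts the closed interval [a,b] inside the open ball of radius δ.
  set a := t₀ - δ / 2 with ha
  set b := t₀ + δ / 2 with hb
  have hab : a < b := by linarith
  have hbox : ∀ x ∈ Ioo (x₀ - ε) (x₀ + ε), ∀ t ∈ Icc a b,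
      (x, t) ∈ U ∧ 0 < (star c * d (x, t)).re := fun x hx t ht =>
    hAB (hεA x hx) (hδB t ⟨by linarith [ht.1], by linarith [ht.2]⟩)
  set f : L2 n l := indicatorConstLp 2 (measurableSet_Icc (a := a) (b := b))
    (measure_ne_top _ _) (EuclideanSpace.single j (1 : ℂ)) with hf
  have hfae : f =ᵐ[volume.restrict (Ioo (0 : ℝ) l)]
      (Icc a b).indicator fun _ => EuclideanSpace.single j (1 : ℂ) := indicatorConstLp_coeFn
  have hVI : ∀ {E : ℝ → ℝ → Matrix (Fin n) (Fin n) ℂ},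
      ContinuousOn (Function.uncurry E) (triangle l) → ∀ x ∈ Ioo (x₀ - ε) (x₀ + ε),
      (∫ t in (0 : ℝ)..x, act (E x t) (f t)) i = ∫ t in a..b, E x t i j := by
    intro E hE x hx
    have hUa := (hbox x hx a (left_mem_Icc.2 hab.le)).1
    have hUb := (hbox x hx b (right_mem_Icc.2 hab.le)).1
    have hx0 : 0 ≤ x := (hUa.1.trans hUa.2.1).le
    have hErow : ContinuousOn (E x) (Icc 0 x) := by
      refine ContinuousOn.comp (g := Function.uncurry E) hE
        (Continuous.prodMk_right x).continuousOn fun t ht => ?_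
      exact ⟨ht.1, ht.2, hUa.2.2.le⟩
    have c1 := (EuclideanSpace.proj (𝕜 := ℂ) i).intervalIntegral_comp_comm
      (intervalIntegrable_act ⟨hx0, hUa.2.2.le⟩ hErow f)
    simp only [PiLp.proj_apply] at c1
    rw [← c1, intervalIntegral.integral_of_le hx0, intervalIntegral.integral_of_le hab.le,
      integral_Ioc_eq_integral_Ioo, ← integral_Icc_eq_integral_Ioc,
      ← inter_eq_right.2 (show Icc a b ⊆ Ioo 0 x from fun t ht =>
        ⟨hUa.1.trans_le ht.1, ht.2.trans_lt hUb.2.1⟩),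
      ← setIntegral_indicator measurableSet_Icc]
    refine integral_congr_ae ?_
    filter_upwards [ae_restrict_of_ae_restrict_of_subset (Ioo_subset_Ioo_right hUa.2.2.le) hfae]
      with t ht
    rw [ht]
    by_cases htI : t ∈ Icc a b
    · rw [indicator_of_mem htI, indicator_of_mem htI, act_basis]
    · rw [indicator_of_notMem htI, indicator_of_notMem htI, act, map_zero]
      rfl
  -- For almost every x the two kernels give the same value on the test function f, so the integral
  -- of their difference over [a,b] vanishes. For x near x₀ that integral is nonzero, yet such x
  -- fill a set of positive measure.
  have hfalse : ∀ᵐ x ∂(volume.restrict (Ioo (0 : ℝ) l)), x ∉ Ioo (x₀ - ε) (x₀ + ε) := by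
    filter_upwards [hT₁.sub_one_ae f, hT₂.sub_one_ae f] with x e1 e2 hx
    have h3 : (∫ t in (0 : ℝ)..x, act (E₁ x t) (f t)) i =
        (∫ t in (0 : ℝ)..x, act (E₂ x t) (f t)) i := by rw [← e1, ← e2]
    rw [hVI h₁ x hx, hVI h₂ x hx] at h3
    have hrow : ∀ {E : ℝ → ℝ → Matrix (Fin n) (Fin n) ℂ},
        ContinuousOn (Function.uncurry E) (triangle l) →
        ContinuousOn (fun t => E x t i j) (Icc a b) := by
      intro E hE
      refine ContinuousOn.comp (g := fun p : ℝ × ℝ => E p.1 p.2 i j)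
        (continuousOn_pi.1 (continuousOn_pi.1 hE i) j)
        (Continuous.prodMk_right x).continuousOn fun t ht => ?_
      exact hUT (hbox x hx t ht).1
    have hint : ∀ {E : ℝ → ℝ → Matrix (Fin n) (Fin n) ℂ},
        ContinuousOn (Function.uncurry E) (triangle l) →
        IntervalIntegrable (fun t => E x t i j) volume a b := fun hE =>
      (hrow hE).intervalIntegrable_of_Icc hab.le
    have h4 : ∫ t in a..b, d (x, t) = 0 := by
      simp only [hd]
      rw [intervalIntegral.integral_sub (hint h₁) (hint h₂), h3, sub_self]
    have h5 : ∫ t in a..b, (star c * d (x, t)).re = 0 := by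
      have hI : IntervalIntegrable (fun t => star c * d (x, t)) volume a b :=
        ((hint h₁).sub (hint h₂)).const_mul _
      have := Complex.reCLM.intervalIntegral_comp_comm hI
      simp only [Complex.reCLM_apply] at this
      rw [this, intervalIntegral.integral_const_mul, h4, mul_zero, Complex.zero_re]
    have h6 : 0 < ∫ t in a..b, (star c * d (x, t)).re := by
      refine intervalIntegral.intervalIntegral_pos_of_pos_on ?_
        (fun t ht => (hbox x hx t (Ioo_subset_Icc_self ht)).2) hab
      refine ContinuousOn.intervalIntegrable_of_Icc hab.le ?_
      exact Complex.continuous_re.comp_continuousOn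
        (continuousOn_const.mul ((hrow h₁).sub (hrow h₂)))
    exact h6.ne' h5
  have hx₀ : x₀ ∈ Ioo 0 l := ⟨hp.1.trans hp.2.1, hp.2.2⟩
  rw [ae_restrict_iff' measurableSet_Ioo] at hfalse
  have hopen : IsOpen (Ioo 0 l ∩ Ioo (x₀ - ε) (x₀ + ε)) := isOpen_Ioo.inter isOpen_Ioo
  have hmeas : 0 < volume (Ioo 0 l ∩ Ioo (x₀ - ε) (x₀ + ε)) :=
    hopen.measure_pos _ ⟨x₀, hx₀, by constructor <;> linarith⟩
  refine hmeas.ne' (measure_mono_null ?_ hfalse)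
  intro x hx h
  exact h hx.1 hx.2

end Uniqueness

end DiracFactor

theorem mainTheorem7 {m₁ m₂ : ℕ} (Φ : ℝ → Matrix (Fin m₂) (Fin m₁) ℂ)
    (hΦ : ∀ l : ℝ, 0 < l → DiracFactor.BoundedlyDifferentiable Φ l)
    (hΦ0 : Φ 0 = 0)
    (hS : ∀ (l : ℝ) (hl : 0 < l), IsUnit (DiracFactor.structuredOp Φ hl (hΦ l hl))) :
    (∃ E : ℝ → ℝ → Matrix (Fin m₂) (Fin m₂) ℂ,
      ContinuousOn (Function.uncurry E) {p : ℝ × ℝ | 0 ≤ p.2 ∧ p.2 ≤ p.1} ∧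
      ∀ (l : ℝ) (hl : 0 < l),
        DiracFactor.InverseFactorization (DiracFactor.structuredOp Φ hl (hΦ l hl)) E) ∧
    (∀ (l : ℝ) (hl : 0 < l) (E₁ E₂ : ℝ → ℝ → Matrix (Fin m₂) (Fin m₂) ℂ),
      ContinuousOn (Function.uncurry E₁) (DiracFactor.triangle l) →
      ContinuousOn (Function.uncurry E₂) (DiracFactor.triangle l) →
      DiracFactor.InverseFactorization (DiracFactor.structuredOp Φ hl (hΦ l hl)) E₁ →
      DiracFactor.InverseFactorization (DiracFactor.structuredOp Φ hl (hΦ l hl)) E₂ →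
      EqOn (Function.uncurry E₁) (Function.uncurry E₂) (DiracFactor.triangle l)) := by
  open DiracFactor in
  constructor
  · have hk := continuous_clampedKernel hΦ hΦ0
    obtain ⟨g, hgc, hg⟩ := exists_resolvent hk fun l hl =>
      ⟨_, hS l hl, isOneSubKernel_structuredOp hl (hΦ l hl) hΦ0⟩
    -- Row j of E is the conjugate transpose of the solution with right side k(t,x) e_j: since
    -- k(t,r)* = k(r,t), taking adjoints turns the column equation into the row equation for E.
    have hE : ContinuousOn (Function.uncurry fun x t => (Matrix.of fun j i => star (g x j t i) :
        Matrix (Fin m₂) (Fin m₂) ℂ)) {p : ℝ × ℝ | 0 ≤ p.2 ∧ p.2 ≤ p.1} := by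
      refine continuousOn_pi.2 fun j => continuousOn_pi.2 fun i => ?_
      exact continuous_star.comp_continuousOn
        ((EuclideanSpace.proj (𝕜 := ℂ) i).continuous.comp_continuousOn (hgc j))
    refine ⟨_, hE, fun l hl => ?_⟩
    have hEl := hE.mono (show triangle l ⊆ _ from fun p hp => ⟨hp.1, hp.2.1⟩)
    obtain ⟨T, hT⟩ := exists_isVolterra hl hEl
    obtain ⟨D, hD, hV⟩ := hT.volterraBounded hEl
    have hSk := isOneSubKernel_structuredOp hl (hΦ l hl) hΦ0
    refine ⟨T, hT, inverse_eq_of_upper hk (conjTranspose_clampedKernel hΦ0) hl hSk hD hV ?_⟩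
    refine upper_of_resolvent hk (conjTranspose_clampedKernel hΦ0) hl hSk hEl hT (g := g) ?_ ?_ ?_
    · intro x hx j
      exact ContinuousOn.comp (g := fun p : ℝ × ℝ => g p.1 j p.2) (hgc j)
        (Continuous.prodMk_right x).continuousOn fun t ht => ⟨ht.1, ht.2⟩
    · exact fun x _ t _ i j => rfl
    · exact fun x hx j t ht => hg x hx.1.le j t ht
  · rintro l hl E₁ E₂ h₁ h₂ ⟨T₁, hT₁, e₁⟩ ⟨T₂, hT₂, e₂⟩
    obtain ⟨D₁, hD₁, hV₁⟩ := hT₁.volterraBounded h₁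
    obtain ⟨D₂, hD₂, hV₂⟩ := hT₂.volterraBounded h₂
    have h12 : T₁ = T₂ := volterra_factor_unique hl hD₁ hD₂ hV₁ hV₂ (e₁.symm.trans e₂)
    exact kernel_eqOn_of_isVolterra hl h₁ h₂ hT₁ (h12 ▸ hT₂)
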